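/- Write $\langle a\rangle = 1+|a|$, $\widehat f(\xi)=\int_{\mathbb R^2}e^{-ix\cdot\xi}f(x)\,dx$ and $\widetilde u(\tau,\xi)=\int_{\mathbb R^{1+2}}e^{-i(t\tau+x\cdot\xi)}u(t,x)\,dt\,dx$. For $u\in\mathcal S(\mathbb R^{1+2})$ (complex-valued) and $s,b\in\mathbb R$ let $$\|u\|_{X_+^{s,b}}=(2\pi)^{-3/2}\bigl\|\langle\xi\rangle^{s}\,\langle\tau+|\xi|\rangle^{b}\,\widetilde u(\tau,\xi)\bigr\|_{L^2_{\tau,\xi}(\mathbb R^{1+2})}.$$ Fix $\kappa>1$ and define the bilinear operator $(\cdot,\cdot)_{HH\to L}$, acting in the space variable $x\in\mathbb R^2$ only, at each fixed time, by $$\bigl[(f,g)_{HH\to L}\bigr]^{\wedge}(\xi)=\int_{\mathbb R^2}\mathbf 1_{\{|\xi|\le\kappa^{-1}(|\eta|+|\xi-\eta|)\}}\,\widehat f(\eta)\,\widehat g(\xi-\eta)\,d\eta ,$$ and let $|D|^{a}$ be the Fourier multiplier in $x$ with symbol $|\xi|^{a}$. **Corollary.** Let $\varepsilon>0$ and let $s_1,s_2,s_3\in\mathbb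 R$ satisfy $$s_1+s_2+s_3=\tfrac12,\qquad s_1,s_2<\tfrac58,\qquad s_1+s_2>0 .$$ Then there is a constant $C$, depending only on $s_1,s_2,s_3,\varepsilon,\kappa$, such that for all $u,v\in\mathcal S(\mathbb R^{1+2})$ the function $|D|^{-s_3}(u,v)_{HH\to L}$ belongs to $L^2_{t,x}(\mathbb R^{1+2})$ and $$\bigl\||D|^{-s_3}(u,v)_{HH\to L}\bigr\|_{L^2_{t,x}}\le C\,\|u\|_{X_+^{s_1,1/2+\varepsilon}}\,\|v\|_{X_+^{s_2,1/2+\varepsilon}} .$$ -/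

import Mathlib

open MeasureTheory
open scoped ENNReal NNReal SchwartzMap

namespace WaveBilinear

/-- The plane `ℝ²` with its Euclidean norm. -/
abbrev Plane : Type := EuclideanSpace ℝ (Fin 2)

/-- Space-time `ℝ^{1+2}`, with points `(t, x)` (or `(τ, ξ)` on the Fourier side), carrying
the product Lebesgue measure. -/
abbrev SpaceTime : Type := ℝ × Plane

/-- The bracket `⟨a⟩ = 1 + |a|`. -/
noncomputable def bracket (a : ℝ) : ℝ := 1 + |a|

/-- The Fourier transform in space, `f̂(ξ) = ∫ e^{-i x·ξ} f(x) dx`. -/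
noncomputable def spaceFourier (f : Plane → ℂ) (ξ : Plane) : ℂ :=
  ∫ x : Plane, Complex.exp (-(Complex.I * ((inner ℝ x ξ : ℝ) : ℂ))) * f x

/-- The inverse Fourier transform in space, `(2π)^{-2} ∫ e^{i x·ξ} F(ξ) dξ`. -/
noncomputable def spaceFourierInv (F : Plane → ℂ) (x : Plane) : ℂ :=
  (((2 * Real.pi) ^ 2)⁻¹ : ℝ) *
    ∫ ξ : Plane, Complex.exp (Complex.I * ((inner ℝ x ξ : ℝ) : ℂ)) * F ξ

/-- The Fourier transform in space-time,
`ũ(τ, ξ) = ∫ e^{-i (t τ + x·ξ)} u(t, x) dt dx`. -/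
noncomputable def spaceTimeFourier (u : SpaceTime → ℂ) (q : SpaceTime) : ℂ :=
  ∫ p : SpaceTime,
    Complex.exp (-(Complex.I * ((p.1 * q.1 + inner ℝ p.2 q.2 : ℝ) : ℂ))) * u p

/-- The spatial Fourier transform of `(f, g)_{HH→L}`, where `|ξ| ≪ |η| + |ξ - η|` is read as
`|ξ| ≤ κ⁻¹ (|η| + |ξ - η|)`:
`ξ ↦ ∫ 1_{κ |ξ| ≤ |η| + |ξ - η|} f̂(η) ĝ(ξ - η) dη`. -/
noncomputable def hhToLowFourier (κ : ℝ) (f g : Plane → ℂ) (ξ : Plane) : ℂ :=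
  ∫ η : Plane, Set.indicator {η : Plane | κ * ‖ξ‖ ≤ ‖η‖ + ‖ξ - η‖}
    (fun η => spaceFourier f η * spaceFourier g (ξ - η)) η

/-- `|D|^a (f, g)_{HH→L}`: the function on the plane whose spatial Fourier transform is
`|ξ|^a` times that of `(f, g)_{HH→L}`.  For Schwartz `f, g` and `a > -2` that transform
is integrable, so the inversion integral converges absolutely. -/
noncomputable def absDHHToLow (a κ : ℝ) (f g : Plane → ℂ) : Plane → ℂ :=
  spaceFourierInv (fun ξ => ((‖ξ‖ ^ a : ℝ) : ℂ) * hhToLowFourier κ f g ξ)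

/-- `|D|^a (u, v)_{HH→L}` for functions on space-time: the operator acts in the space variable,
at each fixed time. -/
noncomputable def absDHHToLowSpaceTime (a κ : ℝ) (u v : SpaceTime → ℂ) (p : SpaceTime) : ℂ :=
  absDHHToLow a κ (fun x => u (p.1, x)) (fun x => v (p.1, x)) p.2

/-- The norm of `X_+^{s,b}`: the `L²_{t,x}` norm of `⟨D⟩^s ⟨-i∂_t + |D|⟩^b u`, that is
`(2π)^{-3/2} ‖⟨ξ⟩^s ⟨τ + |ξ|⟩^b ũ(τ, ξ)‖_{L²_{τ,ξ}}`. -/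
noncomputable def xPlusNorm (s b : ℝ) (u : SpaceTime → ℂ) : ℝ≥0∞ :=
  ENNReal.ofReal ((2 * Real.pi) ^ (-(3 / 2) : ℝ)) *
    eLpNorm (fun q : SpaceTime =>
      ((bracket ‖q.2‖ ^ s * bracket (q.1 + ‖q.2‖) ^ b : ℝ) : ℂ) * spaceTimeFourier u q) 2 volume

end WaveBilinear

/-!
On the Fourier side the product of `u` and `v` is a convolution, and `HH → L` restricts it to input
frequencies `η`, `ζ` whose sum `ξ = η + ζ` satisfies `κ |ξ| ≤ |η| + |ζ|`. There `η` and `ζ` are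
comparable, so that with `σ = s₁ + s₂ > 0` the two Sobolev weights combine to `⟨η⟩^{-σ}`, and the
multiplier `|ξ|^{-s₃}` is `|ξ|^{σ - 1/2}`. The weights `⟨τ + |η|⟩^{-b}` with `b > 1/2` are square
integrable in the distance to the cone, so integrating over the translated cones `τ + |η| = l`
reduces the claim to half-waves (`exists_lintegral_lintegral_highHigh_le`), that is to the bound
`∬ |ξ|^{σ - 1/2} ⟨η⟩^{-σ} f(η) g(ζ) h(|η| + |ζ|, η + ζ) dη dζ ≤ C ‖f‖ ‖g‖ ‖h‖` over the above region
(`exists_lintegral_highHigh_coneSumTrace_le`).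

Two facts give this bound. Firstly, for fixed `ξ` the level sets of `η ↦ |η| + |ξ - η|` are ellipses
with foci `0` and `ξ` and eccentricity at most `1 / κ`. The gradient of this function is bounded
below on them, and it is convex along lines, so a ball of radius `r` meets each ellipse in an arc of
length `O(r)` (`lintegral_ball_ellipse_le`); by Cauchy–Schwarz, the interaction of an `f` supported
in a ball of radius `r` with any `g` is bounded with the constant `O(r^{1/2})`
(`lintegral_ball_coneSumTrace_le`). Secondly, if `|ξ| ∼ r` and `η ∈ B(z, r)` then
`ζ ∈ B(-z, 2 r)`. The kernel is therefore an average, over the centres `z` and with respect to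
`dr / r`, of localized ones (`kernel_mul_le_lintegral_localize`). At scale `r` the constant is
`r^{σ - 1/2} ⟨η⟩^{-σ} r^{1/2} = (r / ⟨η⟩)^σ` with `r ≲ ⟨η⟩`, which is square integrable with respect
to `dr / r` since `σ > 0`; the Cauchy–Schwarz inequality in `z` and in `r` concludes.

The way back to `u` and `v` is Plancherel's inequality in `x` at fixed `t`, and then in `t` at fixed
`ξ`: the spatial Fourier transform of `(u, v)_{HH → L}` at time `t` is the inverse Fourier transform
in time of the restricted convolution of `ũ` and `ṽ` (`hhToLowFourier_slice_eq`).
-/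

namespace WaveBilinear

/-! ### Change of variables along convex functions of one variable -/

theorem ofReal_mul_setLIntegral_comp_le {f f' : ℝ → ℝ} (hf : ∀ t, HasDerivAt f (f' t) t)
    (hmono : Monotone f') {c : ℝ} (hc : 0 < c) (H : ℝ → ℝ≥0∞) :
    ENNReal.ofReal c * ∫⁻ t in {t | c ≤ f' t}, H (f t) ≤ ∫⁻ s, H s := by
  set S : Set ℝ := {t | c ≤ f' t} with hS
  have hSm : MeasurableSet S := measurableSet_le measurable_const hmono.measurable
  have hconv : Convex ℝ S :=
    (Set.OrdConnected.convex ⟨fun x hx y _ w hw => le_trans hx (hmono hw.1)⟩)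
  have hinj : Set.InjOn f S := by
    refine (strictMonoOn_of_deriv_pos hconv
      (fun t _ => (hf t).continuousAt.continuousWithinAt) ?_).injOn
    intro t ht
    rw [(hf t).deriv]
    have htS : t ∈ S := interior_subset ht
    exact lt_of_lt_of_le hc htS
  rw [← lintegral_const_mul' _ _ ENNReal.ofReal_ne_top]
  calc ∫⁻ t in S, ENNReal.ofReal c * H (f t)
      ≤ ∫⁻ t in S, ENNReal.ofReal |f' t| * H (f t) := by
        refine setLIntegral_mono' hSm fun t ht => ?_
        gcongr
        exact le_trans ht (le_abs_self _)
    _ = ∫⁻ s in f '' S, H s :=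
        (lintegral_image_eq_lintegral_abs_deriv_mul hSm
          (fun t _ => (hf t).hasDerivWithinAt) hinj H).symm
    _ ≤ ∫⁻ s, H s := setLIntegral_le_lintegral _ _

/-- The set where a convex function has slope at least `c` in absolute value consists of two
rays, on each of which the function is injective. -/
theorem ofReal_mul_setLIntegral_comp_le_abs {f f' : ℝ → ℝ} (hf : ∀ t, HasDerivAt f (f' t) t)
    (hmono : Monotone f') {c : ℝ} (hc : 0 < c) (H : ℝ → ℝ≥0∞) :
    ENNReal.ofReal c * ∫⁻ t in {t | c ≤ |f' t|}, H (f t) ≤ 2 * ∫⁻ s, H s := by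
  have h1 := ofReal_mul_setLIntegral_comp_le hf hmono hc H
  have h2 := ofReal_mul_setLIntegral_comp_le (f := fun t => f (-t)) (f' := fun t => -f' (-t))
    (fun t => by
      have h := (hf (-t)).comp t (hasDerivAt_neg t)
      rwa [mul_neg_one] at h)
    (fun s t hst => by simpa using hmono (neg_le_neg hst)) hc H
  have h3 : ∫⁻ t in {t | c ≤ -f' (-t)}, H (f (-t)) = ∫⁻ t in {t | c ≤ -f' t}, H (f t) :=
    (Measure.measurePreserving_neg (volume : Measure ℝ)).setLIntegral_comp_preimage_emb
      (MeasurableEquiv.neg ℝ).measurableEmbedding (fun t => H (f t)) {t | c ≤ -f' t}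
  rw [h3] at h2
  have h4 : {t | c ≤ |f' t|} = {t | c ≤ f' t} ∪ {t | c ≤ -f' t} := by
    ext t; simp [le_abs]
  rw [h4, two_mul]
  calc _ ≤ ENNReal.ofReal c * ((∫⁻ t in {t | c ≤ f' t}, H (f t)) +
        ∫⁻ t in {t | c ≤ -f' t}, H (f t)) :=
        mul_le_mul_right (lintegral_union_le _ _ _) _
    _ = ENNReal.ofReal c * (∫⁻ t in {t | c ≤ f' t}, H (f t)) +
        ENNReal.ofReal c * ∫⁻ t in {t | c ≤ -f' t}, H (f t) := mul_add _ _ _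
    _ ≤ _ := add_le_add h1 h2

/-! ### Slicing elliptic annuli -/

/-- The sum of the distances from `(x, y)` to the foci `0` and `(a, b)`. -/
noncomputable def focalSum (a b x y : ℝ) : ℝ :=
  √(x ^ 2 + y ^ 2) + √((x - a) ^ 2 + (y - b) ^ 2)

/-- The derivative of `focalSum` in the first variable, off the foci. -/
noncomputable def focalSlope (a b x y : ℝ) : ℝ :=
  x / √(x ^ 2 + y ^ 2) + (x - a) / √((x - a) ^ 2 + (y - b) ^ 2)

theorem focalSum_swap (a b x y : ℝ) : focalSum b a y x = focalSum a b x y := by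
  simp only [focalSum, add_comm]

theorem measurable_focalSum (a b : ℝ) : Measurable fun p : ℝ × ℝ => focalSum a b p.1 p.2 := by
  unfold focalSum; fun_prop

theorem measurable_focalSlope (a b : ℝ) :
    Measurable fun p : ℝ × ℝ => focalSlope a b p.1 p.2 := by
  unfold focalSlope; fun_prop

theorem hasDerivAt_sqrt_sq_add_sq (a : ℝ) {p : ℝ} (hp : p ≠ 0) (t : ℝ) :
    HasDerivAt (fun t => √((t - a) ^ 2 + p ^ 2)) ((t - a) / √((t - a) ^ 2 + p ^ 2)) t := by
  have hpos : 0 < (t - a) ^ 2 + p ^ 2 := by positivity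
  have h0 : HasDerivAt (fun t : ℝ => (t - a) ^ 2 + p ^ 2) (2 * (t - a)) t := by
    simpa using (((hasDerivAt_id t).sub_const a).pow 2).add_const (p ^ 2)
  convert h0.sqrt hpos.ne' using 1
  field_simp

theorem monotone_div_sqrt_sq_add_sq {p : ℝ} (hp : p ≠ 0) :
    Monotone fun t : ℝ => t / √(t ^ 2 + p ^ 2) := by
  have key : ∀ s t : ℝ, 0 ≤ s → s ≤ t → s / √(s ^ 2 + p ^ 2) ≤ t / √(t ^ 2 + p ^ 2) := by
    intro s t hs hst
    rw [div_le_div_iff₀ (by positivity) (by positivity)]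
    have ht : 0 ≤ t := hs.trans hst
    have e : ∀ x y : ℝ, 0 ≤ x → x * √(y ^ 2 + p ^ 2) = √(x ^ 2 * (y ^ 2 + p ^ 2)) := by
      intro x y hx
      rw [Real.sqrt_mul (sq_nonneg x), Real.sqrt_sq hx]
    rw [e s t hs, e t s ht]
    apply Real.sqrt_le_sqrt
    have : s ^ 2 ≤ t ^ 2 := by gcongr
    nlinarith [mul_le_mul_of_nonneg_right this (sq_nonneg p)]
  intro s t hst
  rcases le_total 0 s with hs | hs
  · exact key s t hs hst
  rcases le_total 0 t with ht | ht
  · exact (div_nonpos_of_nonpos_of_nonneg hs (Real.sqrt_nonneg _)).trans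
      (div_nonneg ht (Real.sqrt_nonneg _))
  · have := key (-t) (-s) (by linarith) (by linarith)
    simpa [neg_div] using this

theorem hasDerivAt_focalSum {a b y : ℝ} (hy : y ≠ 0) (hyb : y ≠ b) (x : ℝ) :
    HasDerivAt (fun x => focalSum a b x y) (focalSlope a b x y) x := by
  have h1 := hasDerivAt_sqrt_sq_add_sq 0 hy x
  have h2 := hasDerivAt_sqrt_sq_add_sq a (sub_ne_zero.mpr hyb) x
  simp only [sub_zero] at h1
  exact h1.add h2

theorem monotone_focalSlope {a b y : ℝ} (hy : y ≠ 0) (hyb : y ≠ b) :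
    Monotone fun x => focalSlope a b x y := by
  intro s t hst
  exact add_le_add (monotone_div_sqrt_sq_add_sq hy hst)
    (monotone_div_sqrt_sq_add_sq (sub_ne_zero.mpr hyb) (sub_le_sub_right hst a))

/-- Outside the ellipse of eccentricity `1 / κ`, the gradient of the sum of the distances to the
foci is bounded below: its square is `2 (1 + cos θ)`, where `θ` is the angle under which the foci
are seen, and the law of cosines bounds `1 + cos θ`. -/
theorem sq_focalSlope_add_sq_focalSlope_ge {κ a b x y : ℝ} (hκ : 1 < κ)
    (h0 : 0 < x ^ 2 + y ^ 2) (h1 : 0 < (x - a) ^ 2 + (y - b) ^ 2)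
    (h : κ * √(a ^ 2 + b ^ 2) ≤ focalSum a b x y) :
    2 * (1 - (κ ^ 2)⁻¹) ≤ focalSlope a b x y ^ 2 + focalSlope b a y x ^ 2 := by
  unfold focalSlope focalSum at *
  rw [add_comm (y ^ 2), add_comm ((y - b) ^ 2)]
  set A := √(x ^ 2 + y ^ 2) with hA
  set B := √((x - a) ^ 2 + (y - b) ^ 2) with hB
  have hA0 : 0 < A := Real.sqrt_pos.mpr h0
  have hB0 : 0 < B := Real.sqrt_pos.mpr h1
  have hA2 : A ^ 2 = x ^ 2 + y ^ 2 := Real.sq_sqrt h0.le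
  have hB2 : B ^ 2 = (x - a) ^ 2 + (y - b) ^ 2 := Real.sq_sqrt h1.le
  have hκ2 : κ ^ 2 * (a ^ 2 + b ^ 2) ≤ (A + B) ^ 2 := by
    have := pow_le_pow_left₀ (by positivity) h 2
    rwa [mul_pow, Real.sq_sqrt (by positivity)] at this
  have e : (x / A + (x - a) / B) ^ 2 + (y / A + (y - b) / B) ^ 2
      = 2 + 2 * (x * (x - a) + y * (y - b)) / (A * B) := by
    have : (x / A + (x - a) / B) ^ 2 + (y / A + (y - b) / B) ^ 2 =
      (x ^ 2 + y ^ 2) / A ^ 2 + ((x - a) ^ 2 + (y - b) ^ 2) / B ^ 2 +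
       2 * (x * (x - a) + y * (y - b)) / (A * B) := by
      field_simp; ring
    rw [this, ← hA2, ← hB2, div_self (by positivity), div_self (by positivity)]; ring
  rw [e]
  have hd : 2 * (x * (x - a) + y * (y - b)) = A ^ 2 + B ^ 2 - (a ^ 2 + b ^ 2) := by
    rw [hA2, hB2]; ring
  have hle : a ^ 2 + b ^ 2 ≤ (κ ^ 2)⁻¹ * (A + B) ^ 2 := by
    rw [le_inv_mul_iff₀ (by positivity)]; exact hκ2
  have hi : (κ ^ 2)⁻¹ ≤ 1 := inv_le_one_of_one_le₀ (by nlinarith)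
  rw [hd, ← sub_nonneg]
  have : 2 + (A ^ 2 + B ^ 2 - (a ^ 2 + b ^ 2)) / (A * B) - 2 * (1 - (κ ^ 2)⁻¹)
      = (A ^ 2 + B ^ 2 - (a ^ 2 + b ^ 2) + 2 * (κ ^ 2)⁻¹ * (A * B)) / (A * B) := by
    field_simp; ring
  rw [this]
  apply div_nonneg _ (by positivity)
  nlinarith [mul_nonneg (sub_nonneg.mpr hi) (add_nonneg (sq_nonneg A) (sq_nonneg B))]

/-- On a slab `|y - z| < r`, the part where `focalSum` has slope at least `c` along the slab. -/
theorem lintegral_slab_focalSum_le (a b z : ℝ) {c r : ℝ} (hc : 0 < c) (H : ℝ → ℝ≥0∞) :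
    ∫⁻ y, ∫⁻ x, Set.indicator {p : ℝ × ℝ | |p.2 - z| < r ∧ c ≤ |focalSlope a b p.1 p.2|}
      (fun p => H (focalSum a b p.1 p.2)) (x, y)
      ≤ ENNReal.ofReal (4 * r / c) * ∫⁻ s, H s := by
  have hae : ∀ᵐ y : ℝ, y ≠ 0 ∧ y ≠ b := by
    have h1 : ∀ᵐ y : ℝ, y ≠ 0 := by simp [ae_iff, measure_singleton]
    have h2 : ∀ᵐ y : ℝ, y ≠ b := by simp [ae_iff, measure_singleton]
    exact h1.and h2
  have hb : ∀ᵐ y : ℝ, (∫⁻ x, Set.indicator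
      {p : ℝ × ℝ | |p.2 - z| < r ∧ c ≤ |focalSlope a b p.1 p.2|}
      (fun p => H (focalSum a b p.1 p.2)) (x, y)) ≤
      (Metric.ball z r).indicator (fun _ => ENNReal.ofReal (2 / c) * ∫⁻ s, H s) y := by
    filter_upwards [hae] with y hy
    by_cases hyz : |y - z| < r
    · rw [Set.indicator_of_mem (by simpa [Real.dist_eq] using hyz)]
      have hm : MeasurableSet {x | c ≤ |focalSlope a b x y|} :=
        measurableSet_le measurable_const
          ((continuous_abs.measurable).comp (monotone_focalSlope hy.1 hy.2).measurable)
      have h := ofReal_mul_setLIntegral_comp_le_abs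
        (fun x => hasDerivAt_focalSum (a := a) hy.1 hy.2 x)
        (monotone_focalSlope hy.1 hy.2) hc H
      rw [← lintegral_indicator hm] at h
      have e : ENNReal.ofReal (2 / c) = 2 / ENNReal.ofReal c := by
        rw [ENNReal.ofReal_div_of_pos hc]; simp
      rw [e, mul_comm, ← mul_div_assoc, ENNReal.le_div_iff_mul_le
        (Or.inl (by simpa using hc)) (Or.inl ENNReal.ofReal_ne_top), mul_comm, mul_comm _ (2 : ℝ≥0∞)]
      refine le_trans (le_of_eq ?_) h
      congr 1
      refine lintegral_congr fun x => ?_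
      simp only [Set.indicator_apply, Set.mem_ofPred_eq, hyz, true_and]
    · simp [hyz]
  refine (lintegral_mono_ae hb).trans ?_
  rw [lintegral_indicator_const Metric.isOpen_ball.measurableSet, Real.volume_ball, mul_assoc,
    mul_comm _ (ENNReal.ofReal (2 * r)), ← mul_assoc, ← ENNReal.ofReal_mul (by positivity)]
  apply le_of_eq
  congr 2
  ring

theorem lintegral_plane (G : Plane → ℝ≥0∞) (hG : Measurable G) :
    ∫⁻ η, G η = ∫⁻ p : ℝ × ℝ, G !₂[p.1, p.2] := by
  have h := ((EuclideanSpace.volume_preserving_symm_measurableEquiv_toLp (Fin 2)).trans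
    (volume_preserving_finTwoArrow ℝ)).symm
  rw [← h.lintegral_comp hG]
  rfl

theorem norm_plane (x y : ℝ) : ‖(!₂[x, y] : Plane)‖ = √(x ^ 2 + y ^ 2) := by
  simp [EuclideanSpace.norm_eq]

/-- A ball of radius `r` meets an ellipse with foci `0`, `ξ` and eccentricity at most `1 / κ` in
an arc of length `O(r)`, here in the form integrated over the confocal ellipses. -/
theorem lintegral_ball_ellipse_le {κ : ℝ} (hκ : 1 < κ) (ξ z : Plane) (r : ℝ)
    {H : ℝ → ℝ≥0∞} (hH : Measurable H) :
    ∫⁻ η, Set.indicator {η : Plane | η ∈ Metric.ball z r ∧ κ * ‖ξ‖ ≤ ‖η‖ + ‖ξ - η‖}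
      (fun η => H (‖η‖ + ‖ξ - η‖)) η
      ≤ ENNReal.ofReal (8 * r / √(1 - (κ ^ 2)⁻¹)) * ∫⁻ s, H s := by
  have hκ1 : (κ ^ 2)⁻¹ < 1 := inv_lt_one_of_one_lt₀ (by nlinarith)
  set c := √(1 - (κ ^ 2)⁻¹) with hcdef
  have hc : 0 < c := Real.sqrt_pos.mpr (by linarith)
  have hc2 : c ^ 2 = 1 - (κ ^ 2)⁻¹ := Real.sq_sqrt (by linarith)
  rw [lintegral_plane _ (by
    have hm : Measurable fun η : Plane => ‖η‖ + ‖ξ - η‖ := by fun_prop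
    exact (hH.comp hm).indicator (Metric.isOpen_ball.measurableSet.inter
      (measurableSet_le measurable_const hm)))]
  set S : Set (ℝ × ℝ) := {p | |p.2 - z 1| < r ∧ c ≤ |focalSlope (ξ 0) (ξ 1) p.1 p.2|}
  set S' : Set (ℝ × ℝ) := {p | |p.1 - z 0| < r ∧ c ≤ |focalSlope (ξ 1) (ξ 0) p.2 p.1|}
  have hSm : MeasurableSet S := by
    have h1 : Measurable fun p : ℝ × ℝ => |p.2 - z 1| := by fun_prop
    have h2 : Measurable fun p : ℝ × ℝ => |focalSlope (ξ 0) (ξ 1) p.1 p.2| :=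
      continuous_abs.measurable.comp (measurable_focalSlope _ _)
    exact (measurableSet_lt h1 measurable_const).inter (measurableSet_le measurable_const h2)
  have hSm' : MeasurableSet S' := by
    have h1 : Measurable fun p : ℝ × ℝ => |p.1 - z 0| := by fun_prop
    have h2 : Measurable fun p : ℝ × ℝ => |focalSlope (ξ 1) (ξ 0) p.2 p.1| :=
      continuous_abs.measurable.comp ((measurable_focalSlope _ _).comp measurable_swap)
    exact (measurableSet_lt h1 measurable_const).inter (measurableSet_le measurable_const h2)
  set F : ℝ × ℝ → ℝ≥0∞ := fun p => H (focalSum (ξ 0) (ξ 1) p.1 p.2)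
  have hF : Measurable F := hH.comp (measurable_focalSum _ _)
  have hae : ∀ᵐ p : ℝ × ℝ, p ≠ 0 ∧ p ≠ (ξ 0, ξ 1) := by
    have h1 : ∀ᵐ p : ℝ × ℝ, p ≠ 0 := by simp [ae_iff, measure_singleton]
    have h2 : ∀ᵐ p : ℝ × ℝ, p ≠ (ξ 0, ξ 1) := by simp [ae_iff, measure_singleton]
    exact h1.and h2
  have hξ : ξ = !₂[ξ 0, ξ 1] := by ext i; fin_cases i <;> rfl
  have hsum : ∀ x y : ℝ, ‖(!₂[x, y] : Plane)‖ + ‖ξ - !₂[x, y]‖ = focalSum (ξ 0) (ξ 1) x y := by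
    intro x y
    rw [norm_sub_rev, norm_plane, focalSum]
    congr 1
    simp [EuclideanSpace.norm_eq]
  have hball : ∀ x y : ℝ, (!₂[x, y] : Plane) ∈ Metric.ball z r → |x - z 0| < r ∧ |y - z 1| < r := by
    intro x y h
    rw [mem_ball_iff_norm] at h
    have h0 := PiLp.norm_apply_le (!₂[x, y] - z) 0
    have h1 := PiLp.norm_apply_le (!₂[x, y] - z) 1
    simp at h0 h1
    exact ⟨h0.trans_lt h, h1.trans_lt h⟩
  have hle : ∀ᵐ p : ℝ × ℝ,
      Set.indicator {η : Plane | η ∈ Metric.ball z r ∧ κ * ‖ξ‖ ≤ ‖η‖ + ‖ξ - η‖}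
        (fun η => H (‖η‖ + ‖ξ - η‖)) !₂[p.1, p.2] ≤ S.indicator F p + S'.indicator F p := by
    filter_upwards [hae] with p hp
    obtain ⟨x, y⟩ := p
    by_cases hmem : (!₂[x, y] : Plane) ∈ Metric.ball z r ∧
        κ * ‖ξ‖ ≤ ‖(!₂[x, y] : Plane)‖ + ‖ξ - !₂[x, y]‖
    · rw [Set.indicator_of_mem (by exact hmem)]
      simp only [hsum]
      obtain ⟨hx, hy⟩ := hball x y hmem.1
      have hg := sq_focalSlope_add_sq_focalSlope_ge (κ := κ) (a := ξ 0) (b := ξ 1) (x := x) (y := y)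
        hκ (by
          have : x ≠ 0 ∨ y ≠ 0 := by
            by_contra! h; exact hp.1 (by simp [h.1, h.2])
          rcases this with h | h <;> positivity) (by
          have : x - ξ 0 ≠ 0 ∨ y - ξ 1 ≠ 0 := by
            by_contra! h
            exact hp.2 (by rw [sub_eq_zero.mp h.1, sub_eq_zero.mp h.2])
          rcases this with h | h <;> positivity) (by
          have := hmem.2
          rw [hsum] at this
          rwa [hξ, norm_plane] at this)
      rw [← hc2] at hg
      by_cases hs : c ≤ |focalSlope (ξ 0) (ξ 1) x y|
      · rw [Set.indicator_of_mem (show (x, y) ∈ S from ⟨hy, hs⟩)]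
        exact le_self_add
      · have : c ≤ |focalSlope (ξ 1) (ξ 0) y x| := by
          push Not at hs
          apply le_abs.mpr
          have h1 : focalSlope (ξ 0) (ξ 1) x y ^ 2 < c ^ 2 := sq_lt_sq.mpr (by rwa [abs_of_pos hc])
          exact le_abs.mp (abs_le_of_sq_le_sq' (a := c) (b := |focalSlope (ξ 1) (ξ 0) y x|)
            (by rw [sq_abs]; linarith) (abs_nonneg _)).2
        rw [Set.indicator_of_mem (show (x, y) ∈ S' from ⟨hx, this⟩)]
        exact le_add_self
    · rw [Set.indicator_of_notMem (by exact hmem)]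
      exact zero_le
  refine (lintegral_mono_ae hle).trans ?_
  rw [lintegral_add_left (hF.indicator hSm)]
  have e1 : ∫⁻ p, S.indicator F p ≤ ENNReal.ofReal (4 * r / c) * ∫⁻ s, H s := by
    rw [Measure.volume_eq_prod, lintegral_prod_symm' _ (hF.indicator hSm)]
    exact lintegral_slab_focalSum_le (ξ 0) (ξ 1) (z 1) hc H
  have e2 : ∫⁻ p, S'.indicator F p ≤ ENNReal.ofReal (4 * r / c) * ∫⁻ s, H s := by
    rw [Measure.volume_eq_prod, lintegral_prod _ (hF.indicator hSm').aemeasurable]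
    refine le_trans (le_of_eq ?_) (lintegral_slab_focalSum_le (ξ 1) (ξ 0) (z 0) hc H)
    refine lintegral_congr fun x => lintegral_congr fun y => ?_
    simp only [Set.indicator_apply, S', F, Set.mem_ofPred_eq, focalSum_swap]
  refine (add_le_add e1 e2).trans (le_of_eq ?_)
  rw [← add_mul]
  congr 1
  rcases le_total 0 r with hr | hr
  · rw [← ENNReal.ofReal_add (by positivity) (by positivity)]
    congr 1; ring
  · rw [ENNReal.ofReal_of_nonpos (div_nonpos_of_nonpos_of_nonneg (by linarith) hc.le),
      ENNReal.ofReal_of_nonpos (div_nonpos_of_nonpos_of_nonneg (by linarith) hc.le), add_zero]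

/-! ### The `L²` norm of nonnegative functions -/

/-- The `L²` norm of a `[0, ∞]`-valued function. -/
noncomputable def l2Norm {α : Type*} [MeasureSpace α] (f : α → ℝ≥0∞) : ℝ≥0∞ :=
  (∫⁻ a, f a ^ 2) ^ (1 / 2 : ℝ)

theorem l2Norm_sq {α : Type*} [MeasureSpace α] (f : α → ℝ≥0∞) :
    l2Norm f ^ 2 = ∫⁻ a, f a ^ 2 := by
  rw [l2Norm, ← ENNReal.rpow_natCast, ← ENNReal.rpow_mul]
  norm_num

theorem l2Norm_le_of_sq_le {α : Type*} [MeasureSpace α] {f : α → ℝ≥0∞} {c : ℝ≥0∞}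
    (h : ∫⁻ a, f a ^ 2 ≤ c ^ 2) : l2Norm f ≤ c := by
  calc l2Norm f ≤ (c ^ 2) ^ (1 / 2 : ℝ) := by unfold l2Norm; gcongr
    _ = c := by rw [← ENNReal.rpow_natCast, ← ENNReal.rpow_mul]; norm_num

theorem l2Norm_congr {α β : Type*} [MeasureSpace α] [MeasureSpace β] {f : α → ℝ≥0∞}
    {g : β → ℝ≥0∞} (h : ∫⁻ a, f a ^ 2 = ∫⁻ b, g b ^ 2) : l2Norm f = l2Norm g := by
  rw [l2Norm, l2Norm, h]

theorem lintegral_mul_le_l2Norm {α : Type*} [MeasureSpace α] {f g : α → ℝ≥0∞}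
    (hf : Measurable f) (hg : Measurable g) : ∫⁻ a, f a * g a ≤ l2Norm f * l2Norm g := by
  have h := ENNReal.lintegral_mul_le_Lp_mul_Lq (volume : Measure α) Real.HolderConjugate.two_two
    hf.aemeasurable hg.aemeasurable
  simpa [l2Norm] using h

theorem l2Norm_prod_mul {α β : Type*} [MeasureSpace α] [MeasureSpace β]
    [SFinite (volume : Measure β)] {f : α → ℝ≥0∞} {g : β → ℝ≥0∞}
    (hf : Measurable f) (hg : Measurable g) :
    l2Norm (fun p : α × β => f p.1 * g p.2) = l2Norm f * l2Norm g := by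
  have : ∫⁻ p : α × β, (f p.1 * g p.2) ^ 2 = (∫⁻ a, f a ^ 2) * ∫⁻ b, g b ^ 2 := by
    simp_rw [mul_pow]
    exact lintegral_prod_mul (hf.pow_const 2).aemeasurable (hg.pow_const 2).aemeasurable
  rw [l2Norm, this, ENNReal.mul_rpow_of_nonneg _ _ (by norm_num)]
  rfl

/-! ### The interaction at a fixed scale and position -/

/-- The pairs of frequencies `(η, ζ)` whose sum is small, `κ |η + ζ| ≤ |η| + |ζ|`. -/
def highHighSet (κ : ℝ) : Set (Plane × Plane) := {p | κ * ‖p.1 + p.2‖ ≤ ‖p.1‖ + ‖p.2‖}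

theorem measurableSet_highHighSet (κ : ℝ) : MeasurableSet (highHighSet κ) :=
  measurableSet_le (f := fun p : Plane × Plane => κ * ‖p.1 + p.2‖)
    (g := fun p : Plane × Plane => ‖p.1‖ + ‖p.2‖) (by fun_prop) (by fun_prop)

/-- The trace of a space-time function on the image of `(η, ζ) ↦ (|η| + |ζ|, η + ζ)`, where the
Fourier transform of a product of two half-waves lives. -/
noncomputable def coneSumTrace (h : SpaceTime → ℝ≥0∞) (p : Plane × Plane) : ℝ≥0∞ :=
  h (‖p.1‖ + ‖p.2‖, p.1 + p.2)

theorem measurable_coneSumTrace {h : SpaceTime → ℝ≥0∞} (hh : Measurable h) :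
    Measurable (coneSumTrace h) := by
  unfold coneSumTrace
  exact hh.comp (by fun_prop)

/-- The constant in `lintegral_ball_ellipse_le`. -/
noncomputable def ellipseConst (κ : ℝ) : ℝ := 8 / √(1 - (κ ^ 2)⁻¹)

theorem ellipseConst_nonneg (κ : ℝ) : 0 ≤ ellipseConst κ := by unfold ellipseConst; positivity

theorem lintegral_sq_coneSumTrace_le {κ : ℝ} (hκ : 1 < κ) (z : Plane) (r : ℝ)
    {h : SpaceTime → ℝ≥0∞} (hh : Measurable h) :
    ∫⁻ p : Plane × Plane, (((highHighSet κ) ∩ {p | p.1 ∈ Metric.ball z r}).indicator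
      (coneSumTrace h) p) ^ 2 ≤ ENNReal.ofReal (ellipseConst κ * r) * ∫⁻ q, h q ^ 2 := by
  have hS : MeasurableSet ((highHighSet κ) ∩ {p : Plane × Plane | p.1 ∈ Metric.ball z r}) :=
    (measurableSet_highHighSet κ).inter (measurable_fst Metric.isOpen_ball.measurableSet)
  have hm := ((measurable_coneSumTrace hh).indicator hS).pow_const 2
  rw [Measure.volume_eq_prod, lintegral_prod _ hm.aemeasurable]
  have e1 : ∀ η : Plane, ∫⁻ ζ : Plane, (((highHighSet κ) ∩ {p | p.1 ∈ Metric.ball z r}).indicator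
      (coneSumTrace h) (η, ζ)) ^ 2 = ∫⁻ ξ : Plane,
      (((highHighSet κ) ∩ {p | p.1 ∈ Metric.ball z r}).indicator
      (coneSumTrace h) (η, ξ - η)) ^ 2 := fun η =>
    (lintegral_sub_right_eq_self (fun ζ => (((highHighSet κ) ∩ {p | p.1 ∈ Metric.ball z r}).indicator
      (coneSumTrace h) (η, ζ)) ^ 2) η).symm
  simp_rw [e1]
  have hmc : Measurable fun p : Plane × Plane =>
      (((highHighSet κ) ∩ {p | p.1 ∈ Metric.ball z r}).indicator
      (coneSumTrace h) (p.1, p.2 - p.1)) ^ 2 :=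
    hm.comp (g := fun x => _) (f := fun p : Plane × Plane => (p.1, p.2 - p.1)) (by fun_prop)
  rw [lintegral_lintegral_swap hmc.aemeasurable]
  have e2 : ∀ ξ : Plane, ∫⁻ η : Plane, (((highHighSet κ) ∩ {p | p.1 ∈ Metric.ball z r}).indicator
      (coneSumTrace h) (η, ξ - η)) ^ 2 ≤
      ENNReal.ofReal (ellipseConst κ * r) * ∫⁻ s, h (s, ξ) ^ 2 := by
    intro ξ
    have hH : Measurable fun s => h (s, ξ) ^ 2 := (hh.comp (by fun_prop)).pow_const 2
    refine le_trans (le_of_eq ?_) ((lintegral_ball_ellipse_le hκ ξ z r hH).trans (le_of_eq ?_))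
    · refine lintegral_congr fun η => ?_
      by_cases hη : η ∈ Metric.ball z r ∧ κ * ‖ξ‖ ≤ ‖η‖ + ‖ξ - η‖
      · have hη' : (η, ξ - η) ∈ (highHighSet κ) ∩ {p : Plane × Plane | p.1 ∈ Metric.ball z r} :=
          ⟨by simpa [highHighSet] using hη.2, hη.1⟩
        rw [Set.indicator_of_mem hη', Set.indicator_of_mem (by exact hη)]
        simp [coneSumTrace]
      · have hη' : (η, ξ - η) ∉ (highHighSet κ) ∩ {p : Plane × Plane | p.1 ∈ Metric.ball z r} :=
          fun h => hη ⟨h.2, by simpa [highHighSet] using h.1⟩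
        rw [Set.indicator_of_notMem hη', Set.indicator_of_notMem (by exact hη)]
        simp
    · rw [ellipseConst]
      congr 2
      ring
  refine (lintegral_mono e2).trans (le_of_eq ?_)
  have hm2 : Measurable fun q => h q ^ 2 := hh.pow_const 2
  rw [lintegral_const_mul' _ _ ENNReal.ofReal_ne_top, Measure.volume_eq_prod,
    lintegral_prod_symm' _ hm2]

/-- The bilinear interaction of a function in the ball `B(z, r)` with any other one, tested
against a function on space-time. -/
theorem lintegral_ball_coneSumTrace_le {κ : ℝ} (hκ : 1 < κ) (z : Plane) (r : ℝ)
    {f g : Plane → ℝ≥0∞} (hf : Measurable f) (hg : Measurable g)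
    (hfz : ∀ η, η ∉ Metric.ball z r → f η = 0) {h : SpaceTime → ℝ≥0∞} (hh : Measurable h) :
    ∫⁻ p, (highHighSet κ).indicator (fun p => f p.1 * g p.2 * coneSumTrace h p) p ≤
      l2Norm f * l2Norm g * (ENNReal.ofReal (ellipseConst κ * r) ^ (1 / 2 : ℝ) * l2Norm h) := by
  have hS : MeasurableSet ((highHighSet κ) ∩ {p : Plane × Plane | p.1 ∈ Metric.ball z r}) :=
    (measurableSet_highHighSet κ).inter (measurable_fst Metric.isOpen_ball.measurableSet)
  calc ∫⁻ p, (highHighSet κ).indicator (fun p => f p.1 * g p.2 * coneSumTrace h p) p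
      = ∫⁻ p : Plane × Plane, (f p.1 * g p.2) *
        ((highHighSet κ) ∩ {p | p.1 ∈ Metric.ball z r}).indicator (coneSumTrace h) p := by
        refine lintegral_congr fun p => ?_
        by_cases hp : p ∈ highHighSet κ
        · by_cases hz : p.1 ∈ Metric.ball z r
          · rw [Set.indicator_of_mem hp, Set.indicator_of_mem (show p ∈ _ ∩ _ from ⟨hp, hz⟩)]
          · simp [hfz p.1 hz]
        · rw [Set.indicator_of_notMem hp, Set.indicator_of_notMem (s := _ ∩ _) (fun h => hp h.1), mul_zero]
    _ ≤ _ := by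
        refine (lintegral_mul_le_l2Norm (by fun_prop)
          ((measurable_coneSumTrace hh).indicator hS)).trans ?_
        rw [l2Norm_prod_mul hf hg]
        gcongr
        rw [l2Norm, l2Norm, ← ENNReal.mul_rpow_of_nonneg _ _ (by norm_num)]
        gcongr
        exact lintegral_sq_coneSumTrace_le hκ z r hh

/-! ### Localization to balls of radius comparable with the output frequency -/

theorem bracket_pos (a : ℝ) : 0 < bracket a := by unfold bracket; positivity

theorem one_le_bracket (a : ℝ) : 1 ≤ bracket a := by
  unfold bracket; linarith [abs_nonneg a]

@[fun_prop]
theorem continuous_bracket : Continuous bracket := by unfold bracket; fun_prop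

@[fun_prop]
theorem measurable_bracket : Measurable bracket := continuous_bracket.measurable

/-- The restriction of `f` to the ball `B(z, r)`, damped by `(r / ⟨η⟩)^σ`, at those frequencies
which can produce an output of size `r`. The scale and the centre are `q = (r, z)`. -/
noncomputable def localizeDamped (σ c : ℝ) (f : Plane → ℝ≥0∞) (q : SpaceTime) (η : Plane) : ℝ≥0∞ :=
  {x : SpaceTime × Plane | dist x.2 x.1.2 < x.1.1 ∧ x.1.1 ≤ c * bracket ‖x.2‖}.indicator
    (fun x => ENNReal.ofReal (x.1.1 ^ σ * bracket ‖x.2‖ ^ (-σ)) * f x.2) (q, η)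

/-- The restriction of `g` to the ball `B(-z, 2 r)`, where `q = (r, z)`. -/
noncomputable def localizeOpposite (g : Plane → ℝ≥0∞) (q : SpaceTime) (ζ : Plane) : ℝ≥0∞ :=
  {x : SpaceTime × Plane | dist x.2 (-x.1.2) < 2 * x.1.1}.indicator (fun x => g x.2) (q, ζ)

/-- The restriction of `h` to spatial frequencies `ξ` with `|ξ| < r < 2 |ξ|`. -/
noncomputable def localizeOutput (h : SpaceTime → ℝ≥0∞) (r : ℝ) (p : SpaceTime) : ℝ≥0∞ :=
  {x : ℝ × SpaceTime | ‖x.2.2‖ < x.1 ∧ x.1 < 2 * ‖x.2.2‖}.indicator (fun x => h x.2) (r, p)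

theorem measurable_localizeDamped (σ c : ℝ) {f : Plane → ℝ≥0∞} (hf : Measurable f) :
    Measurable (Function.uncurry (localizeDamped σ c f)) := by
  refine Measurable.indicator ?_ ?_
  · exact (ENNReal.measurable_ofReal.comp ((measurable_fst.fst.pow_const σ).mul
      ((measurable_bracket.comp measurable_snd.norm).pow_const _))).mul (hf.comp measurable_snd)
  · exact (measurableSet_lt (measurable_snd.dist measurable_fst.snd) measurable_fst.fst).inter
      (measurableSet_le measurable_fst.fst
        ((measurable_bracket.comp measurable_snd.norm).const_mul c))

theorem measurable_localizeOpposite {g : Plane → ℝ≥0∞} (hg : Measurable g) :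
    Measurable (Function.uncurry (localizeOpposite g)) := by
  refine Measurable.indicator (hg.comp measurable_snd) ?_
  exact measurableSet_lt (measurable_snd.dist measurable_fst.snd.neg)
    (measurable_fst.fst.const_mul 2)

theorem measurable_localizeOutput {h : SpaceTime → ℝ≥0∞} (hh : Measurable h) :
    Measurable (Function.uncurry (localizeOutput h)) := by
  refine Measurable.indicator (hh.comp measurable_snd) ?_
  exact (measurableSet_lt measurable_snd.snd.norm measurable_fst).inter
    (measurableSet_lt measurable_fst (measurable_snd.snd.norm.const_mul 2))

theorem lintegral_volume_prod {α β : Type*} [MeasureSpace α] [MeasureSpace β]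
    [SFinite (volume : Measure β)] {F : α × β → ℝ≥0∞} (hF : Measurable F) :
    ∫⁻ p, F p = ∫⁻ a, ∫⁻ b, F (a, b) :=
  lintegral_prod F hF.aemeasurable

theorem measurable_l2Norm_slice {α β : Type*} [MeasureSpace α] [MeasureSpace β]
    [SFinite (volume : Measure β)] {F : α → β → ℝ≥0∞} (hF : Measurable (Function.uncurry F)) :
    Measurable fun a => l2Norm (F a) := by
  exact (Measurable.lintegral_prod_right' (hF.pow_const 2)).pow_const _

theorem setLIntegral_Ioc_rpow {s R : ℝ} (hs : 0 < s) (hR : 0 ≤ R) :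
    ∫⁻ r in Set.Ioc 0 R, ENNReal.ofReal (r ^ (s - 1)) = ENNReal.ofReal (R ^ s / s) := by
  have hint : IntegrableOn (fun r : ℝ => r ^ (s - 1)) (Set.Ioc 0 R) :=
    (intervalIntegrable_iff_integrableOn_Ioc_of_le hR).mp
      (intervalIntegral.intervalIntegrable_rpow' (by linarith))
  rw [← ofReal_integral_eq_lintegral_ofReal hint, ← intervalIntegral.integral_of_le hR,
    integral_rpow (Or.inl (by linarith))]
  · simp [Real.zero_rpow hs.ne']
  · refine (ae_restrict_iff' measurableSet_Ioc).mpr (ae_of_all _ fun r hr => ?_)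
    exact Real.rpow_nonneg hr.1.le _

/-- Integration over scales: the damping `(r / ⟨η⟩)^σ` makes the integral with respect to
`dr / r` converge. -/
theorem lintegral_sq_localizeDamped_le {σ c : ℝ} (hσ : 0 < σ) (hc : 0 < c) {f : Plane → ℝ≥0∞}
    (hf : Measurable f) :
    ∫⁻ q : SpaceTime, (Set.Ioi (0 : ℝ)).indicator (fun r => ENNReal.ofReal (r ^ (-3 : ℝ))) q.1 *
      ∫⁻ η, localizeDamped σ c f q η ^ 2 ≤
    ENNReal.ofReal (Real.pi * (c ^ (2 * σ) / (2 * σ))) * ∫⁻ η, f η ^ 2 := by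
  have hwm : Measurable ((Set.Ioi (0 : ℝ)).indicator
      fun r : ℝ => ENNReal.ofReal (r ^ (-3 : ℝ))) :=
    (ENNReal.measurable_ofReal.comp (measurable_id.pow_const _)).indicator measurableSet_Ioi
  have hm := measurable_localizeDamped σ c hf
  have hm1 : Measurable fun x : SpaceTime × Plane => (Set.Ioi (0 : ℝ)).indicator
      (fun r => ENNReal.ofReal (r ^ (-3 : ℝ))) x.1.1 * localizeDamped σ c f x.1 x.2 ^ 2 :=
    (hwm.comp measurable_fst.fst).mul (hm.pow_const 2)
  have e1 : ∀ q : SpaceTime, (Set.Ioi (0 : ℝ)).indicator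
      (fun r => ENNReal.ofReal (r ^ (-3 : ℝ))) q.1 * ∫⁻ η, localizeDamped σ c f q η ^ 2 =
      ∫⁻ η, (Set.Ioi (0 : ℝ)).indicator
      (fun r => ENNReal.ofReal (r ^ (-3 : ℝ))) q.1 * localizeDamped σ c f q η ^ 2 := fun q =>
    (lintegral_const_mul _ ((hm.comp measurable_prodMk_left).pow_const 2)).symm
  simp_rw [e1]
  rw [lintegral_lintegral_swap hm1.aemeasurable, ← lintegral_const_mul _ (hf.pow_const 2)]
  refine lintegral_mono fun η => ?_
  have hm2 : Measurable fun q : SpaceTime => (Set.Ioi (0 : ℝ)).indicator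
      (fun r => ENNReal.ofReal (r ^ (-3 : ℝ))) q.1 * localizeDamped σ c f q η ^ 2 :=
    hm1.comp (measurable_id.prodMk measurable_const)
  rw [lintegral_volume_prod hm2]
  have hb := bracket_pos ‖η‖
  set B := bracket ‖η‖ with hB
  have e2 : ∀ r : ℝ, ∫⁻ z : Plane, (Set.Ioi (0 : ℝ)).indicator
      (fun r => ENNReal.ofReal (r ^ (-3 : ℝ))) r * localizeDamped σ c f (r, z) η ^ 2 ≤
      (Set.Ioc 0 (c * B)).indicator (fun r => ENNReal.ofReal (r ^ (2 * σ - 1))) r *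
        (ENNReal.ofReal (B ^ (-2 * σ) * Real.pi) * f η ^ 2) := by
    intro r
    by_cases hr : r ∈ Set.Ioc 0 (c * B)
    · have hr0 : 0 < r := hr.1
      rw [Set.indicator_of_mem hr, Set.indicator_of_mem (show r ∈ Set.Ioi 0 from hr.1)]
      have : ∀ z : Plane, ENNReal.ofReal (r ^ (-3 : ℝ)) * localizeDamped σ c f (r, z) η ^ 2 =
          (Metric.ball η r).indicator (fun _ => ENNReal.ofReal (r ^ (-3 : ℝ)) *
            (ENNReal.ofReal (r ^ σ * B ^ (-σ)) * f η) ^ 2) z := by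
        intro z
        by_cases hz : dist η z < r
        · rw [Set.indicator_of_mem (by rwa [Metric.mem_ball, dist_comm]), localizeDamped,
            Set.indicator_of_mem (by exact ⟨hz, hr.2⟩)]
        · rw [Set.indicator_of_notMem (by rwa [Metric.mem_ball, dist_comm]), localizeDamped,
            Set.indicator_of_notMem (fun h => hz h.1)]
          simp
      simp_rw [this]
      rw [lintegral_indicator_const Metric.isOpen_ball.measurableSet,
        EuclideanSpace.volume_ball_fin_two, mul_pow, ← ENNReal.ofReal_pow (by positivity),
        ← ENNReal.ofReal_pow hr0.le]
      apply le_of_eq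
      calc _ = ENNReal.ofReal (r ^ (-3 : ℝ)) * ENNReal.ofReal ((r ^ σ * B ^ (-σ)) ^ 2) *
            ENNReal.ofReal (r ^ 2) * ENNReal.ofReal Real.pi * f η ^ 2 := by ring
        _ = ENNReal.ofReal (r ^ (2 * σ - 1)) * (ENNReal.ofReal (B ^ (-2 * σ) * Real.pi)) *
            f η ^ 2 := by
            rw [← ENNReal.ofReal_mul (by positivity), ← ENNReal.ofReal_mul (by positivity),
              ← ENNReal.ofReal_mul (by positivity), ← ENNReal.ofReal_mul (by positivity)]
            congr 2
            have e3 : r ^ (2 * σ - 1) = r ^ (-3 : ℝ) * (r ^ σ) ^ 2 * r ^ 2 := by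
              rw [← Real.rpow_natCast, ← Real.rpow_natCast, ← Real.rpow_mul hr0.le,
                ← Real.rpow_add hr0, ← Real.rpow_add hr0]
              congr 1; push_cast; ring
            have e4 : B ^ (-2 * σ) = (B ^ (-σ)) ^ 2 := by
              rw [← Real.rpow_natCast, ← Real.rpow_mul hb.le]
              congr 1; push_cast; ring
            rw [e3, e4]; ring
        _ = _ := by ring
    · refine le_of_eq_of_le ?_ zero_le
      rw [lintegral_eq_zero_of_ae_eq_zero]
      refine ae_of_all _ fun z => ?_
      by_cases h0 : 0 < r
      · have : localizeDamped σ c f (r, z) η = 0 :=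
          Set.indicator_of_notMem (fun h => hr ⟨h0, h.2⟩) _
        simp [this]
      · rw [Set.indicator_of_notMem (by exact h0)]
        simp
  refine (lintegral_mono e2).trans ?_
  have hwm2 : Measurable ((Set.Ioc 0 (c * B)).indicator
      fun r : ℝ => ENNReal.ofReal (r ^ (2 * σ - 1))) :=
    (ENNReal.measurable_ofReal.comp (measurable_id.pow_const _)).indicator measurableSet_Ioc
  rw [lintegral_mul_const _ hwm2, lintegral_indicator
    measurableSet_Ioc, setLIntegral_Ioc_rpow (by positivity) (by positivity), ← mul_assoc,
    ← ENNReal.ofReal_mul (by positivity)]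
  apply le_of_eq
  congr 2
  rw [Real.mul_rpow hc.le hb.le]
  have : B ^ (2 * σ) * B ^ (-2 * σ) = 1 := by
    rw [← Real.rpow_add hb]; simp
  calc _ = (B ^ (2 * σ) * B ^ (-2 * σ)) * (c ^ (2 * σ) / (2 * σ) * Real.pi) := by ring
    _ = _ := by rw [this]; ring

theorem lintegral_sq_localizeOpposite_localizeOutput_le {g : Plane → ℝ≥0∞} (hg : Measurable g)
    {h : SpaceTime → ℝ≥0∞} (hh : Measurable h) :
    ∫⁻ q : SpaceTime, (Set.Ioi (0 : ℝ)).indicator (fun r => ENNReal.ofReal (r ^ (-3 : ℝ))) q.1 *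
      ((∫⁻ ζ, localizeOpposite g q ζ ^ 2) * ∫⁻ p, localizeOutput h q.1 p ^ 2) ≤
    ENNReal.ofReal (4 * Real.pi) * (∫⁻ ζ, g ζ ^ 2) * ∫⁻ p, h p ^ 2 := by
  have hwm : Measurable ((Set.Ioi (0 : ℝ)).indicator
      fun r : ℝ => ENNReal.ofReal (r ^ (-3 : ℝ))) :=
    (ENNReal.measurable_ofReal.comp (measurable_id.pow_const _)).indicator measurableSet_Ioi
  have hmg := (measurable_localizeOpposite hg).pow_const 2
  have hmh := (measurable_localizeOutput hh).pow_const 2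
  have hIg : Measurable fun q : SpaceTime => ∫⁻ ζ, localizeOpposite g q ζ ^ 2 :=
    hmg.lintegral_prod_right'
  have hIh : Measurable fun r : ℝ => ∫⁻ p, localizeOutput h r p ^ 2 :=
    hmh.lintegral_prod_right'
  have hmq : Measurable fun q : SpaceTime => (Set.Ioi (0 : ℝ)).indicator
      (fun r => ENNReal.ofReal (r ^ (-3 : ℝ))) q.1 *
      ((∫⁻ ζ, localizeOpposite g q ζ ^ 2) * ∫⁻ p, localizeOutput h q.1 p ^ 2) :=
    (hwm.comp measurable_fst).mul (hIg.mul (hIh.comp measurable_fst))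
  rw [lintegral_volume_prod hmq]
  have e1 : ∀ r : ℝ, ∫⁻ z : Plane, ∫⁻ ζ, localizeOpposite g (r, z) ζ ^ 2 =
      ENNReal.ofReal (2 * r) ^ 2 * ENNReal.ofReal Real.pi * ∫⁻ ζ, g ζ ^ 2 := by
    intro r
    have hm' : Measurable fun x : Plane × Plane => localizeOpposite g (r, x.1) x.2 ^ 2 :=
      hmg.comp (g := fun x : SpaceTime × Plane => _)
        (f := fun x : Plane × Plane => ((r, x.1), x.2)) (by fun_prop)
    rw [lintegral_lintegral_swap hm'.aemeasurable, ← lintegral_const_mul _ (hg.pow_const 2)]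
    refine lintegral_congr fun ζ => ?_
    have : ∀ z : Plane, localizeOpposite g (r, z) ζ ^ 2 =
        (Metric.ball (-ζ) (2 * r)).indicator (fun _ => g ζ ^ 2) z := by
      intro z
      have hz' : z ∈ Metric.ball (-ζ) (2 * r) ↔ dist ζ (-z) < 2 * r := by
        rw [Metric.mem_ball, dist_comm, ← dist_neg_neg, neg_neg]
      by_cases hz : dist ζ (-z) < 2 * r
      · rw [Set.indicator_of_mem (hz'.mpr hz), localizeOpposite,
          Set.indicator_of_mem (by exact hz)]
      · rw [Set.indicator_of_notMem (fun h => hz (hz'.mp h)), localizeOpposite,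
          Set.indicator_of_notMem (by exact hz)]
        simp
    simp_rw [this]
    rw [lintegral_indicator_const Metric.isOpen_ball.measurableSet,
      EuclideanSpace.volume_ball_fin_two, mul_comm]
  have e2 : ∀ r : ℝ, ∫⁻ z : Plane, (Set.Ioi (0 : ℝ)).indicator
      (fun r => ENNReal.ofReal (r ^ (-3 : ℝ))) r * ((∫⁻ ζ, localizeOpposite g (r, z) ζ ^ 2) *
        ∫⁻ p, localizeOutput h r p ^ 2) =
      (ENNReal.ofReal (4 * Real.pi) * ∫⁻ ζ, g ζ ^ 2) *
        ∫⁻ p, (Set.Ioi (0 : ℝ)).indicator (fun r => ENNReal.ofReal (r⁻¹)) r *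
          localizeOutput h r p ^ 2 := by
    intro r
    have hIgr : Measurable fun z : Plane => ∫⁻ ζ, localizeOpposite g (r, z) ζ ^ 2 :=
      hIg.comp measurable_prodMk_left
    have hmhr : Measurable fun p => localizeOutput h r p ^ 2 :=
      (measurable_localizeOutput hh).of_uncurry_left.pow_const 2
    rw [lintegral_const_mul _ (hIgr.mul_const _), lintegral_mul_const _ hIgr, e1,
      lintegral_const_mul _ hmhr]
    by_cases hr : 0 < r
    · rw [Set.indicator_of_mem (show r ∈ Set.Ioi 0 from hr),
        Set.indicator_of_mem (show r ∈ Set.Ioi 0 from hr)]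
      have : ENNReal.ofReal (r ^ (-3 : ℝ)) * (ENNReal.ofReal (2 * r) ^ 2 *
          ENNReal.ofReal Real.pi) = ENNReal.ofReal (4 * Real.pi) * ENNReal.ofReal (r⁻¹) := by
        rw [← ENNReal.ofReal_pow (by positivity), ← ENNReal.ofReal_mul (by positivity),
          ← ENNReal.ofReal_mul (by positivity), ← ENNReal.ofReal_mul (by positivity)]
        congr 1
        have : r ^ (-3 : ℝ) = (r ^ 3)⁻¹ := by
          rw [Real.rpow_neg hr.le]; norm_cast
        rw [this]; field_simp; ring
      calc _ = (ENNReal.ofReal (r ^ (-3 : ℝ)) * (ENNReal.ofReal (2 * r) ^ 2 *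
          ENNReal.ofReal Real.pi)) * (∫⁻ ζ, g ζ ^ 2) * ∫⁻ p, localizeOutput h r p ^ 2 := by ring
        _ = _ := by rw [this]; ring
    · rw [Set.indicator_of_notMem (by exact hr), Set.indicator_of_notMem (by exact hr)]
      simp
  simp_rw [e2]
  have hm3 : Measurable fun x : ℝ × SpaceTime => (Set.Ioi (0 : ℝ)).indicator
      (fun r => ENNReal.ofReal (r⁻¹)) x.1 * localizeOutput h x.1 x.2 ^ 2 :=
    (((ENNReal.measurable_ofReal.comp measurable_inv).indicator measurableSet_Ioi).comp
      measurable_fst).mul hmh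
  rw [lintegral_const_mul _ hm3.lintegral_prod_right', lintegral_lintegral_swap hm3.aemeasurable]
  gcongr with p
  have e3 : ∀ r : ℝ, (Set.Ioi (0 : ℝ)).indicator (fun r => ENNReal.ofReal (r⁻¹)) r *
      localizeOutput h r p ^ 2 ≤ (Set.Ioo ‖p.2‖ (2 * ‖p.2‖)).indicator
        (fun _ => ENNReal.ofReal (‖p.2‖⁻¹) * h p ^ 2) r := by
    intro r
    by_cases hr : ‖p.2‖ < r ∧ r < 2 * ‖p.2‖
    · have hp0 : 0 < ‖p.2‖ := by linarith [hr.1.trans hr.2]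
      rw [localizeOutput, Set.indicator_of_mem (show r ∈ Set.Ioi 0 from hp0.trans hr.1),
        Set.indicator_of_mem (by exact hr),
        Set.indicator_of_mem (show r ∈ Set.Ioo ‖p.2‖ (2 * ‖p.2‖) from hr)]
      gcongr
      exact hr.1.le
    · rw [localizeOutput, Set.indicator_of_notMem (s := {x : ℝ × SpaceTime | _}) (by exact hr)]
      simp
  refine (lintegral_mono e3).trans ?_
  rw [lintegral_indicator_const measurableSet_Ioo, Real.volume_Ioo, mul_right_comm,
    ← ENNReal.ofReal_mul (by positivity)]
  refine mul_le_of_le_one_left' ?_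
  rw [ENNReal.ofReal_le_one]
  rcases eq_or_lt_of_le (norm_nonneg p.2) with h0 | h0
  · simp [← h0]
  · apply le_of_eq; field_simp; ring

/-! ### The trilinear estimate for half-waves -/

theorem rpow_le_two_rpow_abs_mul_rpow {a r : ℝ} (x : ℝ) (ha : 0 < a) (h1 : a < r)
    (h2 : r < 2 * a) : a ^ x ≤ 2 ^ |x| * r ^ x := by
  have hr : 0 < r := ha.trans h1
  rcases le_total 0 x with hx | hx
  · calc a ^ x ≤ r ^ x := Real.rpow_le_rpow ha.le h1.le hx
      _ ≤ 2 ^ |x| * r ^ x := le_mul_of_one_le_left (by positivity)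
        (Real.one_le_rpow (by norm_num) (abs_nonneg x))
  · rw [abs_of_nonpos hx]
    calc a ^ x ≤ (r / 2) ^ x := Real.rpow_le_rpow_of_nonpos (by positivity) (by linarith) hx
      _ = 2 ^ (-x) * r ^ x := by
        rw [Real.div_rpow hr.le (by norm_num), Real.rpow_neg (by norm_num)]; field_simp

/-- The pairs (scale, centre) at which the localizations see frequencies `η`, `ξ - η` have total
mass bounded below. -/
theorem ofReal_le_lintegral_scale_centre (η : Plane) {a : ℝ} (ha : 0 < a) :
    ENNReal.ofReal (Real.pi / 2) ≤ ∫⁻ q : SpaceTime,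
      {q : SpaceTime | (a < q.1 ∧ q.1 < 2 * a) ∧ dist q.2 η < q.1}.indicator
        (fun q => ENNReal.ofReal (q.1 ^ (-3 : ℝ))) q := by
  have hm : Measurable ({q : SpaceTime | (a < q.1 ∧ q.1 < 2 * a) ∧ dist q.2 η < q.1}.indicator
      fun q : SpaceTime => ENNReal.ofReal (q.1 ^ (-3 : ℝ))) := by
    refine Measurable.indicator
      (ENNReal.measurable_ofReal.comp (measurable_fst.pow_const _)) ?_
    exact ((measurableSet_lt measurable_const measurable_fst).inter
      (measurableSet_lt measurable_fst measurable_const)).inter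
      (measurableSet_lt (measurable_snd.dist measurable_const) measurable_fst)
  rw [lintegral_volume_prod hm]
  have h1 : ∀ r : ℝ, (Set.Ioo a (2 * a)).indicator
      (fun _ => ENNReal.ofReal (Real.pi / (2 * a))) r ≤ ∫⁻ z : Plane,
      {q : SpaceTime | (a < q.1 ∧ q.1 < 2 * a) ∧ dist q.2 η < q.1}.indicator
        (fun q => ENNReal.ofReal (q.1 ^ (-3 : ℝ))) (r, z) := by
    intro r
    by_cases hr : r ∈ Set.Ioo a (2 * a)
    · rw [Set.indicator_of_mem hr]
      have hr0 : 0 < r := ha.trans hr.1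
      have : ∀ z : Plane, {q : SpaceTime | (a < q.1 ∧ q.1 < 2 * a) ∧ dist q.2 η < q.1}.indicator
          (fun q => ENNReal.ofReal (q.1 ^ (-3 : ℝ))) (r, z) =
          (Metric.ball η r).indicator (fun _ => ENNReal.ofReal (r ^ (-3 : ℝ))) z := by
        intro z
        by_cases hz : z ∈ Metric.ball η r
        · rw [Set.indicator_of_mem hz, Set.indicator_of_mem (by exact ⟨hr, hz⟩)]
        · rw [Set.indicator_of_notMem hz, Set.indicator_of_notMem (fun h => hz h.2)]
      simp_rw [this]
      rw [lintegral_indicator_const Metric.isOpen_ball.measurableSet,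
        EuclideanSpace.volume_ball_fin_two, ← ENNReal.ofReal_pow hr0.le,
        ← ENNReal.ofReal_mul (by positivity), ← ENNReal.ofReal_mul (by positivity)]
      apply ENNReal.ofReal_le_ofReal
      have e : r ^ (-3 : ℝ) * (r ^ 2 * Real.pi) = Real.pi / r := by
        have : r ^ (-3 : ℝ) = (r ^ 3)⁻¹ := by
          rw [Real.rpow_neg hr0.le]; norm_cast
        rw [this]; field_simp
      rw [e]
      exact div_le_div_of_nonneg_left Real.pi_pos.le hr0 hr.2.le
    · rw [Set.indicator_of_notMem hr]
      exact zero_le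
  refine le_trans (le_of_eq ?_) (lintegral_mono h1)
  rw [lintegral_indicator_const measurableSet_Ioo, Real.volume_Ioo,
    ← ENNReal.ofReal_mul (by positivity)]
  congr 1
  field_simp
  ring

theorem norm_le_of_mem_highHighSet {κ : ℝ} (hκ : 1 < κ) {p : Plane × Plane}
    (hp : p ∈ highHighSet κ) : ‖p.1 + p.2‖ ≤ 2 / (κ - 1) * ‖p.1‖ := by
  have h1 : κ * ‖p.1 + p.2‖ ≤ ‖p.1‖ + ‖p.2‖ := hp
  have h2 : ‖p.2‖ ≤ ‖p.1 + p.2‖ + ‖p.1‖ := by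
    simpa using norm_sub_le (p.1 + p.2) p.1
  rw [div_mul_eq_mul_div, le_div_iff₀ (by linarith)]
  linarith

/-- The kernel of the bilinear estimate is dominated by an average of localized ones. -/
theorem kernel_mul_le_lintegral_localize {κ : ℝ} (hκ : 1 < κ) (σ : ℝ) {f g : Plane → ℝ≥0∞}
    {h : SpaceTime → ℝ≥0∞} {p : Plane × Plane} (hp : p ∈ highHighSet κ) (hp0 : p.1 + p.2 ≠ 0) :
    ENNReal.ofReal (Real.pi / 2) *
      (ENNReal.ofReal (‖p.1 + p.2‖ ^ (σ - 1 / 2) * bracket ‖p.1‖ ^ (-σ)) *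
        (f p.1 * g p.2 * coneSumTrace h p)) ≤
    ENNReal.ofReal (2 ^ |σ - 1 / 2|) * ∫⁻ q : SpaceTime,
      (Set.Ioi (0 : ℝ)).indicator (fun r => ENNReal.ofReal (r ^ (-(7 / 2) : ℝ))) q.1 *
      (localizeDamped σ (4 / (κ - 1)) f q p.1 * localizeOpposite g q p.2 *
        coneSumTrace (localizeOutput h q.1) p) := by
  have ha : 0 < ‖p.1 + p.2‖ := norm_pos_iff.mpr hp0
  have hle := norm_le_of_mem_highHighSet hκ hp
  obtain ⟨η, ζ⟩ := p
  simp only at *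
  set a := ‖η + ζ‖
  set X := f η * g ζ * coneSumTrace h (η, ζ) with hX
  have hb := bracket_pos ‖η‖
  set E := {q : SpaceTime | (a < q.1 ∧ q.1 < 2 * a) ∧ dist q.2 η < q.1}
  have hEm : MeasurableSet E :=
    ((measurableSet_lt measurable_const measurable_fst).inter
      (measurableSet_lt measurable_fst measurable_const)).inter
      (measurableSet_lt (measurable_snd.dist measurable_const) measurable_fst)
  have hm : Measurable (E.indicator fun q : SpaceTime => ENNReal.ofReal (q.1 ^ (-3 : ℝ))) :=
    (ENNReal.measurable_ofReal.comp (measurable_fst.pow_const _)).indicator hEm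
  refine (mul_le_mul_left (ofReal_le_lintegral_scale_centre η ha) _).trans ?_
  rw [← lintegral_mul_const _ hm, ← lintegral_const_mul' _ _ ENNReal.ofReal_ne_top]
  refine lintegral_mono fun q => ?_
  by_cases hq : q ∈ E
  · obtain ⟨r, z⟩ := q
    have hr1 : a < r := hq.1.1
    have hr2 : r < 2 * a := hq.1.2
    have hz : dist z η < r := hq.2
    have hr0 : 0 < r := ha.trans hr1
    have e1 : localizeDamped σ (4 / (κ - 1)) f (r, z) η =
        ENNReal.ofReal (r ^ σ * bracket ‖η‖ ^ (-σ)) * f η := by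
      refine Set.indicator_of_mem ?_ _
      refine ⟨by rwa [dist_comm] at hz, ?_⟩
      have hb1 : ‖η‖ ≤ bracket ‖η‖ := by rw [bracket, abs_norm]; linarith
      have : 2 * (2 / (κ - 1) * ‖η‖) ≤ 4 / (κ - 1) * bracket ‖η‖ := by
        rw [← mul_assoc]
        have hk : 0 ≤ 4 / (κ - 1) := div_nonneg (by norm_num) (by linarith)
        calc 2 * (2 / (κ - 1)) * ‖η‖ = 4 / (κ - 1) * ‖η‖ := by ring
          _ ≤ _ := mul_le_mul_of_nonneg_left hb1 hk
      show r ≤ 4 / (κ - 1) * bracket ‖η‖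
      linarith
    have e2 : localizeOpposite g (r, z) ζ = g ζ := by
      refine Set.indicator_of_mem ?_ _
      show dist ζ (-z) < 2 * r
      calc dist ζ (-z) = ‖(η + ζ) + (z - η)‖ := by rw [dist_eq_norm]; congr 1; abel
        _ ≤ ‖η + ζ‖ + ‖z - η‖ := norm_add_le _ _
        _ < r + r := add_lt_add hr1 (by rwa [← dist_eq_norm])
        _ = 2 * r := by ring
    have e3 : coneSumTrace (localizeOutput h r) (η, ζ) = coneSumTrace h (η, ζ) := by
      unfold coneSumTrace localizeOutput
      exact Set.indicator_of_mem (by exact ⟨hr1, hr2⟩) _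
    rw [Set.indicator_of_mem hq, Set.indicator_of_mem (show r ∈ Set.Ioi 0 from hr0), e1, e2, e3]
    calc _ = ENNReal.ofReal (r ^ (-3 : ℝ) * (a ^ (σ - 1 / 2) * bracket ‖η‖ ^ (-σ))) * X := by
          rw [ENNReal.ofReal_mul (p := r ^ (-3 : ℝ)) (by positivity), mul_assoc]
      _ ≤ ENNReal.ofReal (2 ^ |σ - 1 / 2| * (r ^ (-(7 / 2) : ℝ) * (r ^ σ * bracket ‖η‖ ^ (-σ)))) *
          X := by
          refine mul_le_mul_left (ENNReal.ofReal_le_ofReal ?_) _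
          have := rpow_le_two_rpow_abs_mul_rpow (σ - 1 / 2) ha hr1 hr2
          have e4 : r ^ (-(7 / 2) : ℝ) * r ^ σ = r ^ (-3 : ℝ) * r ^ (σ - 1 / 2) := by
            rw [← Real.rpow_add hr0, ← Real.rpow_add hr0]; congr 1; ring
          calc _ ≤ r ^ (-3 : ℝ) * ((2 ^ |σ - 1 / 2| * r ^ (σ - 1 / 2)) * bracket ‖η‖ ^ (-σ)) := by
                gcongr
            _ = 2 ^ |σ - 1 / 2| * ((r ^ (-3 : ℝ) * r ^ (σ - 1 / 2)) * bracket ‖η‖ ^ (-σ)) := by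
                ring
            _ = _ := by rw [← e4]; ring
      _ = _ := by
          rw [ENNReal.ofReal_mul (by positivity), ENNReal.ofReal_mul (by positivity), hX]
          ring
  · rw [Set.indicator_of_notMem hq, zero_mul]
    exact zero_le

theorem ae_add_ne_zero : ∀ᵐ p : Plane × Plane, p.1 + p.2 ≠ 0 := by
  have hm : MeasurableSet {p : Plane × Plane | p.1 + p.2 = 0} :=
    measurableSet_eq_fun (by fun_prop) measurable_const
  rw [ae_iff]
  simp only [not_not]
  rw [Measure.volume_eq_prod, Measure.measure_prod_null hm]
  refine ae_of_all _ fun η => ?_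
  have : Prod.mk η ⁻¹' {p : Plane × Plane | p.1 + p.2 = 0} = {-η} := by
    ext ζ; simp [add_eq_zero_iff_eq_neg']
  simp [this]

/-- The weighted `L²` norm of the localizations over all scales and centres. -/
theorem l2Norm_weight_localizeDamped_le {σ c : ℝ} (hσ : 0 < σ) (hc : 0 < c) {f : Plane → ℝ≥0∞}
    (hf : Measurable f) :
    l2Norm (fun q : SpaceTime => (Set.Ioi (0 : ℝ)).indicator
      (fun r => ENNReal.ofReal (r ^ (-(3 / 2) : ℝ))) q.1 * l2Norm (localizeDamped σ c f q)) ≤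
    ENNReal.ofReal √(Real.pi * (c ^ (2 * σ) / (2 * σ))) * l2Norm f := by
  apply l2Norm_le_of_sq_le
  rw [mul_pow, l2Norm_sq, ← ENNReal.ofReal_pow (by positivity), Real.sq_sqrt (by positivity)]
  refine le_trans (le_of_eq ?_) (lintegral_sq_localizeDamped_le hσ hc hf)
  refine lintegral_congr fun q => ?_
  rw [mul_pow, l2Norm_sq]
  congr 1
  by_cases hq : q.1 ∈ Set.Ioi 0
  · have hq0 : 0 < q.1 := hq
    rw [Set.indicator_of_mem hq, Set.indicator_of_mem hq, ← ENNReal.ofReal_pow (by positivity),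
      ← Real.rpow_natCast, ← Real.rpow_mul hq0.le]
    norm_num
  · rw [Set.indicator_of_notMem hq, Set.indicator_of_notMem hq]; simp

theorem l2Norm_weight_localizeOpposite_localizeOutput_le {g : Plane → ℝ≥0∞} (hg : Measurable g)
    {h : SpaceTime → ℝ≥0∞} (hh : Measurable h) :
    l2Norm (fun q : SpaceTime => (Set.Ioi (0 : ℝ)).indicator
      (fun r => ENNReal.ofReal (r ^ (-(3 / 2) : ℝ))) q.1 *
        (l2Norm (localizeOpposite g q) * l2Norm (localizeOutput h q.1))) ≤
    ENNReal.ofReal √(4 * Real.pi) * l2Norm g * l2Norm h := by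
  apply l2Norm_le_of_sq_le
  rw [mul_pow, mul_pow, l2Norm_sq, l2Norm_sq, ← ENNReal.ofReal_pow (by positivity),
    Real.sq_sqrt (by positivity)]
  refine le_trans (le_of_eq ?_) (lintegral_sq_localizeOpposite_localizeOutput_le hg hh)
  refine lintegral_congr fun q => ?_
  rw [mul_pow, mul_pow, l2Norm_sq, l2Norm_sq]
  congr 1
  by_cases hq : q.1 ∈ Set.Ioi 0
  · have hq0 : 0 < q.1 := hq
    rw [Set.indicator_of_mem hq, Set.indicator_of_mem hq, ← ENNReal.ofReal_pow (by positivity),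
      ← Real.rpow_natCast, ← Real.rpow_mul hq0.le]
    norm_num
  · rw [Set.indicator_of_notMem hq, Set.indicator_of_notMem hq]; simp

theorem measurable_localized_kernel (κ σ c : ℝ) {f g : Plane → ℝ≥0∞} {h : SpaceTime → ℝ≥0∞}
    (hf : Measurable f) (hg : Measurable g) (hh : Measurable h) :
    Measurable fun x : (Plane × Plane) × SpaceTime =>
      (highHighSet κ).indicator (fun p => localizeDamped σ c f x.2 p.1 *
        localizeOpposite g x.2 p.2 * coneSumTrace (localizeOutput h x.2.1) p) x.1 := by
  have hmS : MeasurableSet {x : (Plane × Plane) × SpaceTime | x.1 ∈ highHighSet κ} :=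
    measurable_fst (measurableSet_highHighSet κ)
  have h1 : Measurable fun x : (Plane × Plane) × SpaceTime =>
      Function.uncurry (localizeDamped σ c f) (x.2, x.1.1) :=
    (measurable_localizeDamped σ c hf).comp (measurable_snd.prodMk measurable_fst.fst)
  have h2 : Measurable fun x : (Plane × Plane) × SpaceTime =>
      Function.uncurry (localizeOpposite g) (x.2, x.1.2) :=
    (measurable_localizeOpposite hg).comp (measurable_snd.prodMk measurable_fst.snd)
  have h3 : Measurable fun x : (Plane × Plane) × SpaceTime =>
      Function.uncurry (localizeOutput h) (x.2.1, (‖x.1.1‖ + ‖x.1.2‖, x.1.1 + x.1.2)) :=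
    (measurable_localizeOutput hh).comp (measurable_snd.fst.prodMk ((measurable_fst.fst.norm.add
      measurable_fst.snd.norm).prodMk (measurable_fst.fst.add measurable_fst.snd)))
  exact ((h1.mul h2).mul h3).indicator hmS

/-- The bilinear `L²` estimate for the product of two half-waves with the same sign and an output
frequency much smaller than the input ones, in dual form. -/
theorem exists_lintegral_highHigh_coneSumTrace_le {κ σ : ℝ} (hκ : 1 < κ) (hσ : 0 < σ) :
    ∃ C : ℝ≥0, ∀ {f g : Plane → ℝ≥0∞} {h : SpaceTime → ℝ≥0∞}, Measurable f → Measurable g →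
      Measurable h →
      ∫⁻ p : Plane × Plane, (highHighSet κ).indicator (fun p =>
        ENNReal.ofReal (‖p.1 + p.2‖ ^ (σ - 1 / 2) * bracket ‖p.1‖ ^ (-σ)) *
          (f p.1 * g p.2 * coneSumTrace h p)) p ≤ C * (l2Norm f * l2Norm g * l2Norm h) := by
  set c := 4 / (κ - 1) with hc
  have hc0 : 0 < c := div_pos (by norm_num) (by linarith)
  set w : ℝ → ℝ≥0∞ := (Set.Ioi (0 : ℝ)).indicator
      (fun r => ENNReal.ofReal (r ^ (-(3 / 2) : ℝ))) with hw
  set ω : ℝ → ℝ≥0∞ := (Set.Ioi (0 : ℝ)).indicator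
      (fun r => ENNReal.ofReal (r ^ (-(7 / 2) : ℝ))) with hω
  have hwm : Measurable w :=
    (ENNReal.measurable_ofReal.comp (measurable_id.pow_const _)).indicator measurableSet_Ioi
  have hωm : Measurable ω :=
    (ENNReal.measurable_ofReal.comp (measurable_id.pow_const _)).indicator measurableSet_Ioi
  set A : ℝ := √(Real.pi * (c ^ (2 * σ) / (2 * σ)))
  set M : ℝ := 2 ^ |σ - 1 / 2|
  refine ⟨Real.toNNReal ((Real.pi / 2)⁻¹ * (M * (√(ellipseConst κ) * (A * √(4 * Real.pi))))), ?_⟩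
  intro f g h hf hg hh
  have hmF := measurable_localizeDamped σ c hf
  have hmG := measurable_localizeOpposite hg
  have hmH := measurable_localizeOutput hh
  have hωw : ∀ r : ℝ, ω r * ENNReal.ofReal (ellipseConst κ * r) ^ (1 / 2 : ℝ) =
      ENNReal.ofReal √(ellipseConst κ) * (w r * w r) := by
    intro r
    by_cases hr : r ∈ Set.Ioi 0
    · have hr0 : 0 < r := hr
      have hE := ellipseConst_nonneg κ
      rw [hω, hw, Set.indicator_of_mem hr, Set.indicator_of_mem hr,
        ENNReal.ofReal_rpow_of_nonneg (by positivity) (by norm_num),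
        ← ENNReal.ofReal_mul (by positivity), ← ENNReal.ofReal_mul (by positivity),
        ← ENNReal.ofReal_mul (by positivity), Real.mul_rpow hE hr0.le, ← Real.sqrt_eq_rpow]
      congr 1
      have : r ^ (-(7 / 2) : ℝ) * r ^ (1 / 2 : ℝ) = r ^ (-(3 / 2) : ℝ) * r ^ (-(3 / 2) : ℝ) := by
        rw [← Real.rpow_add hr0, ← Real.rpow_add hr0]; norm_num
      rw [← this]; ring
    · rw [hω, hw, Set.indicator_of_notMem hr, Set.indicator_of_notMem hr]; simp
  have key : ENNReal.ofReal (Real.pi / 2) * ∫⁻ p : Plane × Plane,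
      (highHighSet κ).indicator (fun p =>
        ENNReal.ofReal (‖p.1 + p.2‖ ^ (σ - 1 / 2) * bracket ‖p.1‖ ^ (-σ)) *
          (f p.1 * g p.2 * coneSumTrace h p)) p ≤
      ENNReal.ofReal (M * (√(ellipseConst κ) * (A * √(4 * Real.pi)))) *
        (l2Norm f * l2Norm g * l2Norm h) := by
    have hmI : Measurable fun x : (Plane × Plane) × SpaceTime =>
        ω x.2.1 * (highHighSet κ).indicator (fun p => localizeDamped σ c f x.2 p.1 *
          localizeOpposite g x.2 p.2 * coneSumTrace (localizeOutput h x.2.1) p) x.1 :=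
      (hωm.comp measurable_snd.fst).mul (measurable_localized_kernel κ σ c hf hg hh)
    calc _ = ∫⁻ p : Plane × Plane, ENNReal.ofReal (Real.pi / 2) *
          (highHighSet κ).indicator (fun p =>
          ENNReal.ofReal (‖p.1 + p.2‖ ^ (σ - 1 / 2) * bracket ‖p.1‖ ^ (-σ)) *
          (f p.1 * g p.2 * coneSumTrace h p)) p :=
          (lintegral_const_mul' _ _ ENNReal.ofReal_ne_top).symm
      _ ≤ ∫⁻ p : Plane × Plane, ENNReal.ofReal M * ∫⁻ q : SpaceTime, ω q.1 *
          (highHighSet κ).indicator (fun p => localizeDamped σ c f q p.1 *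
          localizeOpposite g q p.2 * coneSumTrace (localizeOutput h q.1) p) p := by
          refine lintegral_mono_ae ?_
          filter_upwards [ae_add_ne_zero] with p hp0
          by_cases hp : p ∈ highHighSet κ
          · simp only [Set.indicator_of_mem hp]
            exact kernel_mul_le_lintegral_localize hκ σ hp hp0
          · simp only [Set.indicator_of_notMem hp]
            simp
      _ = ENNReal.ofReal M * ∫⁻ q : SpaceTime, ω q.1 * ∫⁻ p : Plane × Plane,
          (highHighSet κ).indicator (fun p => localizeDamped σ c f q p.1 *
          localizeOpposite g q p.2 * coneSumTrace (localizeOutput h q.1) p) p := by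
          rw [lintegral_const_mul' _ _ ENNReal.ofReal_ne_top,
            lintegral_lintegral_swap hmI.aemeasurable]
          congr 1
          refine lintegral_congr fun q => lintegral_const_mul' _ _ ?_
          by_cases hq : q.1 ∈ Set.Ioi 0
          · rw [hω, Set.indicator_of_mem hq]; exact ENNReal.ofReal_ne_top
          · rw [hω, Set.indicator_of_notMem hq]; exact ENNReal.zero_ne_top
      _ ≤ ENNReal.ofReal M * ∫⁻ q : SpaceTime, ENNReal.ofReal √(ellipseConst κ) *
          ((w q.1 * l2Norm (localizeDamped σ c f q)) *
          (w q.1 * (l2Norm (localizeOpposite g q) * l2Norm (localizeOutput h q.1)))) := by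
          refine mul_le_mul_right (lintegral_mono fun q => ?_) _
          have hloc := lintegral_ball_coneSumTrace_le hκ q.2 q.1
            (f := localizeDamped σ c f q) (g := localizeOpposite g q) (h := localizeOutput h q.1)
            hmF.of_uncurry_left hmG.of_uncurry_left
            (fun η hη => Set.indicator_of_notMem (fun h => hη h.1) _) hmH.of_uncurry_left
          refine (mul_le_mul_right hloc (ω q.1)).trans (le_of_eq ?_)
          calc _ = (ω q.1 * ENNReal.ofReal (ellipseConst κ * q.1) ^ (1 / 2 : ℝ)) *
                (l2Norm (localizeDamped σ c f q) * (l2Norm (localizeOpposite g q) *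
                l2Norm (localizeOutput h q.1))) := by ring
            _ = _ := by rw [hωw]; ring
      _ ≤ ENNReal.ofReal M * (ENNReal.ofReal √(ellipseConst κ) *
          ((ENNReal.ofReal A * l2Norm f) *
            (ENNReal.ofReal √(4 * Real.pi) * l2Norm g * l2Norm h))) := by
          rw [lintegral_const_mul' _ _ ENNReal.ofReal_ne_top]
          refine mul_le_mul_right (mul_le_mul_right ?_ _) _
          refine (lintegral_mul_le_l2Norm ?_ ?_).trans (mul_le_mul'
            (l2Norm_weight_localizeDamped_le hσ hc0 hf)
            (l2Norm_weight_localizeOpposite_localizeOutput_le hg hh))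
          · exact (hwm.comp measurable_fst).mul (measurable_l2Norm_slice hmF)
          · exact (hwm.comp measurable_fst).mul ((measurable_l2Norm_slice hmG).mul
              ((measurable_l2Norm_slice hmH).comp measurable_fst))
      _ = _ := by
          rw [ENNReal.ofReal_mul (by positivity), ENNReal.ofReal_mul (by positivity),
            ENNReal.ofReal_mul (by positivity)]
          ring
  have hpi : ENNReal.ofReal (Real.pi / 2)⁻¹ * ENNReal.ofReal (Real.pi / 2) = 1 := by
    rw [← ENNReal.ofReal_mul (by positivity), inv_mul_cancel₀ (by positivity), ENNReal.ofReal_one]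
  calc _ = ENNReal.ofReal (Real.pi / 2)⁻¹ * (ENNReal.ofReal (Real.pi / 2) *
        ∫⁻ p : Plane × Plane, (highHighSet κ).indicator (fun p =>
        ENNReal.ofReal (‖p.1 + p.2‖ ^ (σ - 1 / 2) * bracket ‖p.1‖ ^ (-σ)) *
          (f p.1 * g p.2 * coneSumTrace h p)) p) := by rw [← mul_assoc, hpi, one_mul]
    _ ≤ _ := by
        refine (mul_le_mul_right key _).trans (le_of_eq ?_)
        rw [← mul_assoc, ← ENNReal.ofReal_mul (by positivity)]
        rfl

/-! ### Duality -/

theorem l2Norm_le_of_forall_lintegral_mul_le {α : Type*} [MeasureSpace α]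
    [SigmaFinite (volume : Measure α)] {X : α → ℝ≥0∞} (hX : Measurable X) {C : ℝ≥0∞}
    (h : ∀ H : α → ℝ≥0∞, Measurable H → ∫⁻ a, X a * H a ≤ C * l2Norm H) : l2Norm X ≤ C := by
  -- Test against the truncations of `X` itself; these have finite norm.
  set S := spanningSets (volume : Measure α)
  set Y : ℕ → α → ℝ≥0∞ := fun n => (S n).indicator fun a => min (X a) n
  have hYm : ∀ n, Measurable (Y n) := fun n =>
    (hX.min measurable_const).indicator (measurableSet_spanningSets _ n)
  have hYX : ∀ n a, Y n a ≤ X a := fun n a => by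
    by_cases ha : a ∈ S n
    · rw [show Y n a = min (X a) n from Set.indicator_of_mem ha _]; exact min_le_left _ _
    · rw [show Y n a = 0 from Set.indicator_of_notMem ha _]; exact zero_le
  have hfin : ∀ n, l2Norm (Y n) ≠ ∞ := by
    intro n
    refine (ENNReal.rpow_lt_top_of_nonneg (by norm_num) (ne_of_lt ?_)).ne
    calc ∫⁻ a, Y n a ^ 2 ≤ ∫⁻ a, (S n).indicator (fun _ => (n : ℝ≥0∞) ^ 2) a := by
          refine lintegral_mono fun a => ?_
          by_cases ha : a ∈ S n
          · rw [show Y n a = min (X a) n from Set.indicator_of_mem ha _,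
              Set.indicator_of_mem ha]
            gcongr
            exact min_le_right _ _
          · rw [show Y n a = 0 from Set.indicator_of_notMem ha _]; simp
      _ = (n : ℝ≥0∞) ^ 2 * volume (S n) := lintegral_indicator_const
          (measurableSet_spanningSets _ n) _
      _ < ∞ := ENNReal.mul_lt_top (by simp) (measure_spanningSets_lt_top _ n)
  have hle : ∀ n, l2Norm (Y n) ≤ C := by
    intro n
    rcases eq_or_ne (l2Norm (Y n)) 0 with h0 | h0
    · rw [h0]; exact zero_le
    have h1 : l2Norm (Y n) * l2Norm (Y n) ≤ C * l2Norm (Y n) := by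
      calc l2Norm (Y n) * l2Norm (Y n) = ∫⁻ a, Y n a ^ 2 := by rw [← sq, l2Norm_sq]
        _ ≤ ∫⁻ a, X a * Y n a := by
            refine lintegral_mono fun a => ?_
            rw [sq]
            exact mul_le_mul_left (hYX n a) _
        _ ≤ _ := h _ (hYm n)
    exact (ENNReal.mul_le_mul_iff_left h0 (hfin n)).mp h1
  apply l2Norm_le_of_sq_le
  have hlim : ∀ a, Filter.Tendsto (fun n => Y n a ^ 2) Filter.atTop (nhds (X a ^ 2)) := by
    intro a
    have h1 : Filter.Tendsto (fun n : ℕ => min (X a) (n : ℝ≥0∞)) Filter.atTop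
        (nhds (min (X a) ∞)) := tendsto_const_nhds.min ENNReal.tendsto_nat_nhds_top
    rw [min_eq_left le_top] at h1
    refine ((ENNReal.continuous_pow 2).tendsto _).comp (f := fun n => Y n a) (h1.congr' ?_)
    filter_upwards [Filter.eventually_ge_atTop (spanningSetsIndex volume a)] with n hn
    have ha : a ∈ S n := mem_spanningSets_of_index_le _ _ hn
    exact (show Y n a = min (X a) n from Set.indicator_of_mem ha _).symm
  calc ∫⁻ a, X a ^ 2 = ∫⁻ a, Filter.liminf (fun n => Y n a ^ 2) Filter.atTop :=
        lintegral_congr fun a => (hlim a).liminf_eq.symm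
    _ ≤ Filter.liminf (fun n => ∫⁻ a, Y n a ^ 2) Filter.atTop :=
        lintegral_liminf_le fun n => (hYm n).pow_const 2
    _ ≤ C ^ 2 := by
        refine Filter.liminf_le_of_le (by isBoundedDefault) fun b hb => ?_
        obtain ⟨n, hn⟩ := hb.exists
        refine hn.trans ?_
        rw [← l2Norm_sq]
        gcongr
        exact hle n

/-! ### Foliation of space-time by translated cones -/

theorem lintegral_volume_prod_symm {α β : Type*} [MeasureSpace α] [MeasureSpace β]
    [SFinite (volume : Measure α)] [SFinite (volume : Measure β)] {F : α × β → ℝ≥0∞}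
    (hF : Measurable F) : ∫⁻ p, F p = ∫⁻ b, ∫⁻ a, F (a, b) :=
  lintegral_prod_symm' F hF

/-- The shear carrying the planes `τ = l` to the translates `τ + |ξ| = l` of the backward cone. -/
noncomputable def coneShear (p : SpaceTime) : SpaceTime := (p.1 - ‖p.2‖, p.2)

@[fun_prop]
theorem measurable_coneShear : Measurable coneShear := by unfold coneShear; fun_prop

theorem lintegral_comp_coneShear {X : SpaceTime → ℝ≥0∞} (hX : Measurable X) :
    ∫⁻ p, X (coneShear p) = ∫⁻ p, X p := by
  have hX' : Measurable fun p => X (coneShear p) := hX.comp measurable_coneShear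
  rw [lintegral_volume_prod_symm hX, lintegral_volume_prod_symm hX']
  exact lintegral_congr fun ξ => lintegral_sub_right_eq_self (fun t => X (t, ξ)) ‖ξ‖

theorem l2Norm_reflect_time (s : ℝ) {H : SpaceTime → ℝ≥0∞} (hH : Measurable H) :
    l2Norm (fun q : SpaceTime => H (s - q.1, q.2)) = l2Norm H := by
  refine l2Norm_congr ?_
  have hH' : Measurable fun q : SpaceTime => H (s - q.1, q.2) := hH.comp (by fun_prop)
  rw [lintegral_volume_prod_symm (hH.pow_const 2), lintegral_volume_prod_symm (hH'.pow_const 2)]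
  exact lintegral_congr fun ξ => lintegral_sub_left_eq_self (fun t => H (t, ξ) ^ 2) s

theorem lintegral_lintegral_spaceTime {J : SpaceTime → SpaceTime → ℝ≥0∞}
    (hJ : Measurable (Function.uncurry J)) :
    ∫⁻ p, ∫⁻ q, J p q =
      ∫⁻ l : ℝ, ∫⁻ m : ℝ, ∫⁻ x : Plane × Plane, J (l, x.1) (m, x.2) := by
  have h1 : Measurable fun p => ∫⁻ q, J p q := hJ.lintegral_prod_right'
  rw [lintegral_volume_prod h1]
  refine lintegral_congr fun l => ?_
  have h2 : ∀ η : Plane, ∫⁻ q, J (l, η) q = ∫⁻ m, ∫⁻ ζ, J (l, η) (m, ζ) := fun η =>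
    lintegral_volume_prod hJ.of_uncurry_left
  simp_rw [h2]
  have h3 : Measurable fun x : (Plane × ℝ) × Plane => J (l, x.1.1) (x.1.2, x.2) :=
    hJ.comp (g := Function.uncurry J)
      (f := fun x : (Plane × ℝ) × Plane => ((l, x.1.1), (x.1.2, x.2))) (by fun_prop)
  have h4 : Measurable fun x : Plane × ℝ => ∫⁻ ζ, J (l, x.1) (x.2, ζ) :=
    h3.lintegral_prod_right'
  rw [lintegral_lintegral_swap h4.aemeasurable]
  refine lintegral_congr fun m => ?_
  have h5 : Measurable fun x : Plane × Plane => J (l, x.1) (m, x.2) :=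
    hJ.comp (g := Function.uncurry J)
      (f := fun x : Plane × Plane => ((l, x.1), (m, x.2))) (by fun_prop)
  rw [lintegral_volume_prod h5]

/-- The dual form of the bilinear estimate in `X^{0,b}`: integrate the estimate for half-waves
over the two families of translated cones. -/
theorem exists_lintegral_lintegral_highHigh_le {κ σ b : ℝ} (hκ : 1 < κ) (hσ : 0 < σ)
    (hb : 1 / 2 < b) :
    ∃ C : ℝ≥0, ∀ {F G H : SpaceTime → ℝ≥0∞}, Measurable F → Measurable G → Measurable H →
      ∫⁻ p : SpaceTime, ∫⁻ q : SpaceTime, (highHighSet κ).indicator (fun x =>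
        ENNReal.ofReal (‖x.1 + x.2‖ ^ (σ - 1 / 2) * bracket ‖x.1‖ ^ (-σ))) (p.2, q.2) *
          (ENNReal.ofReal (bracket (p.1 + ‖p.2‖) ^ (-b)) * F p *
          (ENNReal.ofReal (bracket (q.1 + ‖q.2‖) ^ (-b)) * G q) * H (p + q)) ≤
        C * (l2Norm F * l2Norm G * l2Norm H) := by
  obtain ⟨C, hC⟩ := exists_lintegral_highHigh_coneSumTrace_le hκ hσ
  set w : ℝ → ℝ≥0∞ := fun l => ENNReal.ofReal (bracket l ^ (-b)) with hw
  have hwm : Measurable w := ENNReal.measurable_ofReal.comp (measurable_bracket.pow_const _)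
  have hwfin : l2Norm w ≠ ∞ := by
    refine (ENNReal.rpow_lt_top_of_nonneg (by norm_num) ?_).ne
    have hint : Integrable fun x : ℝ => (1 + ‖x‖) ^ (-(2 * b)) :=
      integrable_one_add_norm (by rw [Module.finrank_self]; push_cast; linarith)
    refine ne_of_eq_of_ne (lintegral_congr fun l => ?_) hint.lintegral_lt_top.ne
    have hl := bracket_pos l
    rw [hw, ← ENNReal.ofReal_pow (by positivity), ← Real.rpow_natCast, ← Real.rpow_mul hl.le]
    congr 2
    push_cast; ring
  refine ⟨C * (l2Norm w).toNNReal * (l2Norm w).toNNReal, ?_⟩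
  intro F G H hF hG hH
  push_cast
  rw [ENNReal.coe_toNNReal hwfin]
  have hKm : Measurable ((highHighSet κ).indicator fun x : Plane × Plane =>
      ENNReal.ofReal (‖x.1 + x.2‖ ^ (σ - 1 / 2) * bracket ‖x.1‖ ^ (-σ))) := by
    refine Measurable.indicator (ENNReal.measurable_ofReal.comp ?_) (measurableSet_highHighSet κ)
    exact ((measurable_fst.add measurable_snd).norm.pow_const _).mul
      ((measurable_bracket.comp measurable_fst.norm).pow_const _)
  set K := (highHighSet κ).indicator fun x : Plane × Plane =>
      ENNReal.ofReal (‖x.1 + x.2‖ ^ (σ - 1 / 2) * bracket ‖x.1‖ ^ (-σ)) with hK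
  set J : SpaceTime → SpaceTime → ℝ≥0∞ := fun p q => K (p.2, q.2) *
    (w (p.1 + ‖p.2‖) * F p * (w (q.1 + ‖q.2‖) * G q) * H (p + q)) with hJ
  have hJm : Measurable (Function.uncurry J) := by
    have h1 : Measurable fun x : SpaceTime × SpaceTime => K (x.1.2, x.2.2) :=
      hKm.comp (measurable_fst.snd.prodMk measurable_snd.snd)
    have h2 : Measurable fun p : SpaceTime => w (p.1 + ‖p.2‖) := hwm.comp (by fun_prop)
    exact h1.mul ((((h2.comp measurable_fst).mul (hF.comp measurable_fst)).mul
      ((h2.comp measurable_snd).mul (hG.comp measurable_snd))).mul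
      (hH.comp (measurable_fst.add measurable_snd)))
  have hJm' : Measurable (Function.uncurry fun p q => J (coneShear p) (coneShear q)) :=
    hJm.comp (g := Function.uncurry J)
      (f := fun x : SpaceTime × SpaceTime => (coneShear x.1, coneShear x.2)) (by fun_prop)
  have hFs : Measurable (Function.uncurry fun l η => F (coneShear (l, η))) :=
    hF.comp measurable_coneShear
  have hGs : Measurable (Function.uncurry fun l η => G (coneShear (l, η))) :=
    hG.comp measurable_coneShear
  have hnorm : ∀ {X : SpaceTime → ℝ≥0∞}, Measurable X →
      ∫⁻ l, w l * l2Norm (fun η => X (coneShear (l, η))) ≤ l2Norm w * l2Norm X := by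
    intro X hX
    have hXs : Measurable (Function.uncurry fun l η => X (coneShear (l, η))) :=
      hX.comp measurable_coneShear
    refine (lintegral_mul_le_l2Norm hwm (measurable_l2Norm_slice hXs)).trans (le_of_eq ?_)
    congr 1
    refine l2Norm_congr ?_
    simp_rw [l2Norm_sq]
    have hX2 : Measurable fun p => X (coneShear p) ^ 2 :=
      (hX.comp measurable_coneShear).pow_const 2
    rw [← lintegral_comp_coneShear (hX.pow_const 2), lintegral_volume_prod hX2]
  calc ∫⁻ p : SpaceTime, ∫⁻ q : SpaceTime, J p q
      = ∫⁻ p, ∫⁻ q, J (coneShear p) (coneShear q) := by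
        rw [← lintegral_comp_coneShear (X := fun p => ∫⁻ q, J p q) hJm.lintegral_prod_right']
        exact lintegral_congr fun p =>
          (lintegral_comp_coneShear (X := J (coneShear p)) hJm.of_uncurry_left).symm
    _ = ∫⁻ l : ℝ, ∫⁻ m : ℝ, ∫⁻ x : Plane × Plane,
          J (coneShear (l, x.1)) (coneShear (m, x.2)) := lintegral_lintegral_spaceTime hJm'
    _ ≤ ∫⁻ l : ℝ, ∫⁻ m : ℝ, (w l * l2Norm (fun η => F (coneShear (l, η)))) *
          ((w m * l2Norm (fun ζ => G (coneShear (m, ζ)))) * (C * l2Norm H)) := by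
        refine lintegral_mono fun l => lintegral_mono fun m => ?_
        have hHm : Measurable fun q : SpaceTime => H (l + m - q.1, q.2) :=
          hH.comp (by fun_prop)
        have h := hC (f := fun η => F (coneShear (l, η))) (g := fun ζ => G (coneShear (m, ζ)))
          (h := fun q => H (l + m - q.1, q.2)) hFs.of_uncurry_left hGs.of_uncurry_left hHm
        rw [l2Norm_reflect_time _ hH] at h
        have e : ∀ x : Plane × Plane, J (coneShear (l, x.1)) (coneShear (m, x.2)) =
            (w l * w m) * (highHighSet κ).indicator (fun p =>
              ENNReal.ofReal (‖p.1 + p.2‖ ^ (σ - 1 / 2) * bracket ‖p.1‖ ^ (-σ)) *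
              (F (coneShear (l, p.1)) * G (coneShear (m, p.2)) *
                coneSumTrace (fun q => H (l + m - q.1, q.2)) p)) x := by
          intro x
          have e1 : coneShear (l, x.1) + coneShear (m, x.2) =
              (l + m - (‖x.1‖ + ‖x.2‖), x.1 + x.2) := by
            simp only [coneShear, Prod.mk_add_mk]
            congr 1; ring
          by_cases hx : x ∈ highHighSet κ
          · simp only [hJ, hK, e1, Set.indicator_of_mem hx, coneSumTrace]
            simp only [coneShear, sub_add_cancel, Prod.mk.eta, Set.indicator_of_mem hx]
            ring
          · simp only [hJ, hK, Set.indicator_of_notMem hx]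
            simp [coneShear, Set.indicator_of_notMem hx]
        simp_rw [e]
        rw [lintegral_const_mul' _ _ (ENNReal.mul_ne_top ENNReal.ofReal_ne_top
          ENNReal.ofReal_ne_top)]
        refine (mul_le_mul_right h _).trans (le_of_eq ?_)
        ring
    _ = (∫⁻ l, w l * l2Norm (fun η => F (coneShear (l, η)))) *
          ((∫⁻ m, w m * l2Norm (fun ζ => G (coneShear (m, ζ)))) * (C * l2Norm H)) := by
        have hA : Measurable fun l => w l * l2Norm (fun η => F (coneShear (l, η))) :=
          hwm.mul (measurable_l2Norm_slice hFs)
        have hB : Measurable fun l => w l * l2Norm (fun η => G (coneShear (l, η))) :=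
          hwm.mul (measurable_l2Norm_slice hGs)
        simp_rw [lintegral_const_mul _ (hB.mul_const _), lintegral_mul_const _ hB]
        rw [lintegral_mul_const _ hA]
    _ ≤ (l2Norm w * l2Norm F) * ((l2Norm w * l2Norm G) * (C * l2Norm H)) :=
        mul_le_mul' (hnorm hF) (mul_le_mul_left (hnorm hG) _)
    _ = _ := by ring

/-! ### Plancherel's theorem for integrable functions -/

section Plancherel

open FourierTransform

variable {E : Type*} [NormedAddCommGroup E] [InnerProductSpace ℝ E] [FiniteDimensional ℝ E]
  [MeasurableSpace E] [BorelSpace E]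

/-- The `L²` Fourier transform of an integrable function is given by the Fourier integral. -/
theorem coeFn_fourier_toLp_ae_eq {f : E → ℂ} (h1 : Integrable f) (h2 : MemLp f 2) :
    (𝓕 (h2.toLp f) : Lp ℂ 2 (volume : Measure E)) =ᵐ[volume] 𝓕 f := by
  have hcont : Continuous (𝓕 f) :=
    VectorFourier.fourierIntegral_continuous Real.continuous_fourierChar
      (innerSL ℝ).continuous₂ h1
  refine ae_eq_of_integral_contDiff_smul_eq
    ((Lp.memLp (𝓕 (h2.toLp f))).locallyIntegrable (by norm_num)) hcont.locallyIntegrable ?_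
  intro g hg hgs
  set φ : 𝓢(E, ℂ) := HasCompactSupport.toSchwartzMap (f := fun x => (g x : ℂ))
    (hgs.comp_left Complex.ofReal_zero) (Complex.ofRealCLM.contDiff.comp hg) with hφ
  have hφg : ∀ x, φ x = (g x : ℂ) := fun x => rfl
  have e1 := congrArg (fun T => T φ) (Lp.fourier_toTemperedDistribution_eq (h2.toLp f))
  simp only [TemperedDistribution.fourier_apply, Lp.toTemperedDistribution_apply] at e1
  have e2 : ∫ x, (𝓕 φ) x • (h2.toLp f) x = ∫ x, (𝓕 φ) x • f x := by
    refine integral_congr_ae ?_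
    filter_upwards [h2.coeFn_toLp] with x hx
    rw [hx]
  have e3 : ∫ x, (𝓕 φ) x • f x = ∫ x, φ x • (𝓕 f) x := by
    have := VectorFourier.integral_fourierIntegral_smul_eq_flip (𝕜 := ℝ) (μ := (volume : Measure E))
      (ν := (volume : Measure E)) (e := Real.fourierChar) (L := innerₗ E)
      (f := φ) (g := f) Real.continuous_fourierChar continuous_inner φ.integrable h1
    rw [flip_innerₗ] at this
    rw [SchwartzMap.fourier_coe]
    exact this
  rw [e2, e3] at e1
  simp only [hφg] at e1
  simpa using e1.symm

/-- Plancherel's inequality for the Fourier integral. If `f` is not integrable, the Fourier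
integral is zero by convention and there is nothing to prove. -/
theorem eLpNorm_fourier_le (f : E → ℂ) : eLpNorm (𝓕 f) 2 volume ≤ eLpNorm f 2 volume := by
  by_cases h1 : Integrable f
  · by_cases h2 : eLpNorm f 2 volume = ∞
    · rw [h2]; exact le_top
    · have hm : MemLp f 2 := ⟨h1.1, lt_top_iff_ne_top.mpr h2⟩
      rw [← eLpNorm_congr_ae (coeFn_fourier_toLp_ae_eq h1 hm), ← Lp.enorm_def,
        ← ofReal_norm, Lp.norm_fourier_eq, Lp.norm_toLp, ENNReal.ofReal_toReal h2]
  · have : 𝓕 f = 0 := by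
      ext w
      rw [Real.fourier_eq]
      exact integral_undef fun h => h1 ((Real.fourierIntegral_convergent_iff w).mp h)
    rw [this]
    simp

end Plancherel

/-! ### The bilinear estimate in `X^{s,b}` spaces -/

instance : (volume : Measure SpaceTime).IsAddRightInvariant :=
  inferInstanceAs ((volume : Measure ℝ).prod (volume : Measure Plane)).IsAddRightInvariant

/-- The weight in the `X_+^{s,b}` norm. -/
noncomputable def xPlusWeight (s b : ℝ) (q : SpaceTime) : ℝ :=
  bracket ‖q.2‖ ^ s * bracket (q.1 + ‖q.2‖) ^ b

theorem xPlusWeight_pos (s b : ℝ) (q : SpaceTime) : 0 < xPlusWeight s b q :=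
  mul_pos (Real.rpow_pos_of_pos (bracket_pos _) _) (Real.rpow_pos_of_pos (bracket_pos _) _)

@[fun_prop]
theorem measurable_xPlusWeight (s b : ℝ) : Measurable (xPlusWeight s b) := by
  unfold xPlusWeight; fun_prop

/-- The space-time convolution of two nonnegative functions, restricted to the `HH → L`
interactions of the spatial frequencies. -/
noncomputable def highHighConv (κ : ℝ) (A B : SpaceTime → ℝ≥0∞) (q : SpaceTime) : ℝ≥0∞ :=
  ∫⁻ p : SpaceTime, (highHighSet κ).indicator (fun _ => A p * B (q - p)) (p.2, q.2 - p.2)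

theorem measurable_highHighConv_integrand (κ : ℝ) {A B : SpaceTime → ℝ≥0∞} (hA : Measurable A)
    (hB : Measurable B) : Measurable fun x : SpaceTime × SpaceTime =>
      (highHighSet κ).indicator (fun _ => A x.2 * B (x.1 - x.2)) (x.2.2, x.1.2 - x.2.2) := by
  have hmS : MeasurableSet {x : SpaceTime × SpaceTime | (x.2.2, x.1.2 - x.2.2) ∈ highHighSet κ} :=
    (by fun_prop : Measurable fun x : SpaceTime × SpaceTime => (x.2.2, x.1.2 - x.2.2))
      (measurableSet_highHighSet κ)
  exact ((hA.comp measurable_snd).mul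
    (hB.comp (measurable_fst.sub measurable_snd))).indicator hmS

theorem measurable_highHighConv (κ : ℝ) {A B : SpaceTime → ℝ≥0∞} (hA : Measurable A)
    (hB : Measurable B) : Measurable (highHighConv κ A B) :=
  (measurable_highHighConv_integrand κ hA hB).lintegral_prod_right'

theorem norm_snd_le_of_mem_highHighSet {κ : ℝ} (hκ : 1 < κ) {p : Plane × Plane}
    (hp : p ∈ highHighSet κ) : ‖p.2‖ ≤ (κ + 1) / (κ - 1) * ‖p.1‖ := by
  have h1 := norm_le_of_mem_highHighSet hκ hp
  have h2 : ‖p.2‖ ≤ ‖p.1 + p.2‖ + ‖p.1‖ := by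
    simpa using norm_sub_le (p.1 + p.2) p.1
  have e : (κ + 1) / (κ - 1) = 2 / (κ - 1) + 1 := by
    have : κ - 1 ≠ 0 := by linarith
    field_simp; ring
  rw [e]
  linarith

theorem swap_mem_highHighSet {κ : ℝ} {p : Plane × Plane} (hp : p ∈ highHighSet κ) :
    p.swap ∈ highHighSet κ := by
  have h : κ * ‖p.1 + p.2‖ ≤ ‖p.1‖ + ‖p.2‖ := hp
  show κ * ‖p.2 + p.1‖ ≤ ‖p.2‖ + ‖p.1‖
  rwa [add_comm p.2, add_comm ‖p.2‖]

theorem rpow_le_rpow_abs_mul_rpow {x y A : ℝ} (hx : 0 < x) (hy : 0 < y) (hA : 1 ≤ A)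
    (hxy : x ≤ A * y) (hyx : y ≤ A * x) (s : ℝ) : x ^ s ≤ A ^ |s| * y ^ s := by
  have hA0 : 0 < A := by linarith
  rcases le_total 0 s with hs | hs
  · rw [abs_of_nonneg hs, ← Real.mul_rpow hA0.le hy.le]
    exact Real.rpow_le_rpow hx.le hxy hs
  · rw [abs_of_nonpos hs]
    calc x ^ s ≤ (y / A) ^ s :=
          Real.rpow_le_rpow_of_nonpos (by positivity) (by rwa [div_le_iff₀' hA0]) hs
      _ = A ^ (-s) * y ^ s := by
          rw [Real.div_rpow hy.le hA0.le, Real.rpow_neg hA0.le]; field_simp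

theorem bracket_le_mul_bracket {A : ℝ} (hA : 1 ≤ A) {η ζ : Plane} (h : ‖η‖ ≤ A * ‖ζ‖) :
    bracket ‖η‖ ≤ A * bracket ‖ζ‖ := by
  simp only [bracket, abs_norm]; linarith

/-- On the `HH → L` region the two input frequencies are comparable, so that the Sobolev weights
combine. -/
theorem one_le_mul_bracket_rpow {κ : ℝ} (hκ : 1 < κ) (s₁ s₂ : ℝ) {p : Plane × Plane}
    (hp : p ∈ highHighSet κ) :
    1 ≤ ((κ + 1) / (κ - 1)) ^ |s₂| *
      (bracket ‖p.1‖ ^ (-(s₁ + s₂)) * bracket ‖p.1‖ ^ s₁ * bracket ‖p.2‖ ^ s₂) := by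
  have hA : 1 ≤ (κ + 1) / (κ - 1) := by
    rw [one_le_div (by linarith)]; linarith
  have h1 := bracket_le_mul_bracket hA (norm_snd_le_of_mem_highHighSet hκ hp)
  have h2 := bracket_le_mul_bracket hA
    (norm_snd_le_of_mem_highHighSet hκ (swap_mem_highHighSet hp))
  have hb1 := bracket_pos ‖p.1‖
  have h := rpow_le_rpow_abs_mul_rpow hb1 (bracket_pos _) hA h2 h1 s₂
  calc (1 : ℝ) = bracket ‖p.1‖ ^ (-(s₁ + s₂)) * bracket ‖p.1‖ ^ s₁ * bracket ‖p.1‖ ^ s₂ := by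
        rw [← Real.rpow_add hb1, ← Real.rpow_add hb1]
        rw [show -(s₁ + s₂) + s₁ + s₂ = 0 by ring, Real.rpow_zero]
    _ ≤ bracket ‖p.1‖ ^ (-(s₁ + s₂)) * bracket ‖p.1‖ ^ s₁ *
        (((κ + 1) / (κ - 1)) ^ |s₂| * bracket ‖p.2‖ ^ s₂) := by gcongr; exact h
    _ = _ := by ring

/-- The bilinear estimate on the Fourier side. -/
theorem exists_l2Norm_highHighConv_le {κ s₁ s₂ b : ℝ} (hκ : 1 < κ) (hs : 0 < s₁ + s₂)
    (hb : 1 / 2 < b) :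
    ∃ C : ℝ≥0, ∀ {A B : SpaceTime → ℝ≥0∞}, Measurable A → Measurable B →
      l2Norm (fun q : SpaceTime => ENNReal.ofReal (‖q.2‖ ^ (s₁ + s₂ - 1 / 2)) *
        highHighConv κ A B q) ≤
      C * (l2Norm (fun q => ENNReal.ofReal (xPlusWeight s₁ b q) * A q) *
        l2Norm (fun q => ENNReal.ofReal (xPlusWeight s₂ b q) * B q)) := by
  obtain ⟨C, hC⟩ := exists_lintegral_lintegral_highHigh_le hκ hs hb
  set σ := s₁ + s₂ with hσ
  set M : ℝ := ((κ + 1) / (κ - 1)) ^ |s₂| with hM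
  have hA0 : 0 ≤ (κ + 1) / (κ - 1) := div_nonneg (by linarith) (by linarith)
  have hM0 : 0 ≤ M := Real.rpow_nonneg hA0 _
  refine ⟨M.toNNReal * C, ?_⟩
  intro A B hA hB
  set F : SpaceTime → ℝ≥0∞ := fun q => ENNReal.ofReal (xPlusWeight s₁ b q) * A q with hF
  set G : SpaceTime → ℝ≥0∞ := fun q => ENNReal.ofReal (xPlusWeight s₂ b q) * B q with hG
  have hFm : Measurable F := by fun_prop
  have hGm : Measurable G := by fun_prop
  have hwm : Measurable fun q : SpaceTime => ENNReal.ofReal (‖q.2‖ ^ (σ - 1 / 2)) := by fun_prop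
  refine l2Norm_le_of_forall_lintegral_mul_le (hwm.mul (measurable_highHighConv κ hA hB)) ?_
  intro H hH
  have hIm := measurable_highHighConv_integrand κ hA hB
  have hIm2 : Measurable fun x : SpaceTime × SpaceTime =>
      ENNReal.ofReal (‖x.1.2‖ ^ (σ - 1 / 2)) * (highHighSet κ).indicator
        (fun _ => A x.2 * B (x.1 - x.2)) (x.2.2, x.1.2 - x.2.2) * H x.1 :=
    ((hwm.comp measurable_fst).mul hIm).mul (hH.comp measurable_fst)
  calc ∫⁻ q : SpaceTime, ENNReal.ofReal (‖q.2‖ ^ (σ - 1 / 2)) * highHighConv κ A B q * H q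
      = ∫⁻ q : SpaceTime, ∫⁻ p : SpaceTime, ENNReal.ofReal (‖q.2‖ ^ (σ - 1 / 2)) *
          (highHighSet κ).indicator (fun _ => A p * B (q - p)) (p.2, q.2 - p.2) * H q := by
        refine lintegral_congr fun q => ?_
        have h1 : Measurable fun p : SpaceTime => (highHighSet κ).indicator
            (fun _ => A p * B (q - p)) (p.2, q.2 - p.2) :=
          (show Measurable (Function.uncurry fun q p : SpaceTime => (highHighSet κ).indicator
            (fun _ => A p * B (q - p)) (p.2, q.2 - p.2)) from hIm).of_uncurry_left
        rw [lintegral_mul_const _ (h1.const_mul _), lintegral_const_mul _ h1]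
        rfl
    _ = ∫⁻ p : SpaceTime, ∫⁻ q : SpaceTime, ENNReal.ofReal (‖q.2‖ ^ (σ - 1 / 2)) *
          (highHighSet κ).indicator (fun _ => A p * B (q - p)) (p.2, q.2 - p.2) * H q :=
        lintegral_lintegral_swap hIm2.aemeasurable
    _ = ∫⁻ p : SpaceTime, ∫⁻ q : SpaceTime, ENNReal.ofReal (‖q.2 + p.2‖ ^ (σ - 1 / 2)) *
          (highHighSet κ).indicator (fun _ => A p * B q) (p.2, q.2) * H (q + p) := by
        refine lintegral_congr fun p => ?_
        rw [← lintegral_add_right_eq_self (μ := (volume : Measure SpaceTime)) _ p]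
        simp only [Prod.snd_add, add_sub_cancel_right]
    _ ≤ ∫⁻ p : SpaceTime, ∫⁻ q : SpaceTime, ENNReal.ofReal M * ((highHighSet κ).indicator (fun x =>
        ENNReal.ofReal (‖x.1 + x.2‖ ^ (σ - 1 / 2) * bracket ‖x.1‖ ^ (-σ))) (p.2, q.2) *
          (ENNReal.ofReal (bracket (p.1 + ‖p.2‖) ^ (-b)) * F p *
          (ENNReal.ofReal (bracket (q.1 + ‖q.2‖) ^ (-b)) * G q) * H (p + q))) := by
        refine lintegral_mono fun p => lintegral_mono fun q => ?_
        by_cases hpq : (p.2, q.2) ∈ highHighSet κ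
        · simp only [Set.indicator_of_mem hpq, hF, hG]
          have h1 := one_le_mul_bracket_rpow hκ s₁ s₂ hpq
          simp only at h1
          have hp1 := bracket_pos (p.1 + ‖p.2‖)
          have hq1 := bracket_pos (q.1 + ‖q.2‖)
          have hp2 := bracket_pos ‖p.2‖
          have hq2 := bracket_pos ‖q.2‖
          have ep : bracket (p.1 + ‖p.2‖) ^ (-b) * xPlusWeight s₁ b p = bracket ‖p.2‖ ^ s₁ := by
            rw [xPlusWeight, mul_left_comm, ← Real.rpow_add hp1]; simp
          have eq : bracket (q.1 + ‖q.2‖) ^ (-b) * xPlusWeight s₂ b q = bracket ‖q.2‖ ^ s₂ := by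
            rw [xPlusWeight, mul_left_comm, ← Real.rpow_add hq1]; simp
          calc _ = ENNReal.ofReal (‖p.2 + q.2‖ ^ (σ - 1 / 2)) * (A p * B q) * H (p + q) := by
                rw [add_comm q.2, add_comm q p]
            _ ≤ ENNReal.ofReal (M * (‖p.2 + q.2‖ ^ (σ - 1 / 2) * bracket ‖p.2‖ ^ (-σ) *
                  (bracket (p.1 + ‖p.2‖) ^ (-b) * xPlusWeight s₁ b p *
                  (bracket (q.1 + ‖q.2‖) ^ (-b) * xPlusWeight s₂ b q)))) *
                  (A p * B q) * H (p + q) := by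
                refine mul_le_mul_left (mul_le_mul_left (ENNReal.ofReal_le_ofReal ?_) _) _
                rw [ep, eq]
                calc _ ≤ ‖p.2 + q.2‖ ^ (σ - 1 / 2) * (M * (bracket ‖p.2‖ ^ (-σ) *
                      bracket ‖p.2‖ ^ s₁ * bracket ‖q.2‖ ^ s₂)) :=
                      le_mul_of_one_le_right (by positivity) h1
                  _ = _ := by ring
            _ = _ := by
                have hw1 := (xPlusWeight_pos s₁ b p).le
                have hw2 := (xPlusWeight_pos s₂ b q).le
                rw [ENNReal.ofReal_mul hM0, ENNReal.ofReal_mul (p := _ * bracket ‖p.2‖ ^ (-σ))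
                    (by positivity), ENNReal.ofReal_mul (p := _ * xPlusWeight s₁ b p)
                    (by positivity), ENNReal.ofReal_mul (q := xPlusWeight s₁ b p) (by positivity),
                    ENNReal.ofReal_mul (q := xPlusWeight s₂ b q) (by positivity)]
                ring
        · simp only [Set.indicator_of_notMem hpq]
          simp
    _ ≤ ENNReal.ofReal M * (C * (l2Norm F * l2Norm G * l2Norm H)) := by
        simp_rw [lintegral_const_mul' _ _ ENNReal.ofReal_ne_top]
        exact mul_le_mul_right (hC hFm hGm hH) _
    _ = _ := by
        push_cast
        rw [ENNReal.ofReal]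
        ring

/-! ### Plancherel's inequality with the angular normalization -/

theorem eLpNorm_two_eq_l2Norm {α : Type*} [MeasureSpace α] (f : α → ℂ) :
    eLpNorm f 2 volume = l2Norm fun a => ‖f a‖ₑ := by
  rw [eLpNorm_eq_lintegral_rpow_enorm_toReal (by norm_num) (by norm_num), l2Norm]
  simp

section Plancherel

open FourierTransform

variable {E : Type*} [NormedAddCommGroup E] [InnerProductSpace ℝ E] [FiniteDimensional ℝ E]
  [MeasurableSpace E] [BorelSpace E]

theorem lintegral_comp_smul_eq (g : E → ℝ≥0∞) {r : ℝ} (hr : r ≠ 0) :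
    ∫⁻ x, g (r • x) = ENNReal.ofReal |(r ^ Module.finrank ℝ E)⁻¹| * ∫⁻ x, g x := by
  have h := lintegral_map_equiv (μ := (volume : Measure E)) g
    (Homeomorph.smulOfNeZero r hr).toMeasurableEquiv
  have h2 : (volume : Measure E).map (Homeomorph.smulOfNeZero r hr).toMeasurableEquiv =
      ENNReal.ofReal |(r ^ Module.finrank ℝ E)⁻¹| • (volume : Measure E) :=
    Measure.map_addHaar_smul volume hr
  rw [h2, lintegral_smul_measure] at h
  exact h.symm

theorem lintegral_sq_enorm_exp_integral_le (F : E → ℂ) :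
    ∫⁻ x : E, ‖∫ ξ : E, Complex.exp (Complex.I * ((inner ℝ x ξ : ℝ) : ℂ)) * F ξ‖ₑ ^ 2 ≤
      ENNReal.ofReal ((2 * Real.pi) ^ Module.finrank ℝ E) * ∫⁻ ξ, ‖F ξ‖ₑ ^ 2 := by
  have hr : -(2 * Real.pi)⁻¹ ≠ 0 := by simp [Real.pi_ne_zero]
  have e : ∀ x : E, ∫ ξ : E, Complex.exp (Complex.I * ((inner ℝ x ξ : ℝ) : ℂ)) * F ξ =
      𝓕 F (-(2 * Real.pi)⁻¹ • x) := by
    intro x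
    rw [Real.fourier_eq']
    refine integral_congr_ae (ae_of_all _ fun ξ => ?_)
    simp only [smul_eq_mul]
    congr 2
    rw [inner_smul_right, real_inner_comm, mul_comm Complex.I]
    congr 2
    field_simp
  simp_rw [e]
  rw [lintegral_comp_smul_eq (fun x => ‖𝓕 F x‖ₑ ^ 2) hr]
  have h1 : |((-(2 * Real.pi)⁻¹) ^ Module.finrank ℝ E)⁻¹| =
      (2 * Real.pi) ^ Module.finrank ℝ E := by
    rw [abs_inv, abs_pow, abs_neg, abs_of_pos (by positivity), inv_pow, inv_inv]
  rw [h1]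
  refine mul_le_mul_right ?_ _
  have h2 := eLpNorm_fourier_le F
  rw [eLpNorm_two_eq_l2Norm, eLpNorm_two_eq_l2Norm] at h2
  rw [← l2Norm_sq, ← l2Norm_sq]
  exact pow_le_pow_left' h2 2

end Plancherel

/-! ### Schwartz functions on space-time -/

theorem exists_norm_le_rpow_mul_rpow (Φ : 𝓢(SpaceTime, ℂ)) (k : ℕ) :
    ∃ C : ℝ, 0 ≤ C ∧ ∀ t x, ‖Φ (t, x)‖ ≤
      C * ((1 + ‖t‖) ^ (-(k : ℝ)) * (1 + ‖x‖) ^ (-(k : ℝ))) := by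
  refine ⟨2 ^ (2 * k) * (Finset.Iic (2 * k, 0)).sup
    (fun m => SchwartzMap.seminorm ℝ m.1 m.2) Φ, by positivity, fun t x => ?_⟩
  have h := SchwartzMap.one_add_le_sup_seminorm_apply (𝕜 := ℝ) (m := (2 * k, 0)) (k := 2 * k)
    (n := 0) le_rfl le_rfl Φ (t, x)
  rw [norm_iteratedFDeriv_zero] at h
  refine le_trans ?_ (mul_le_mul_of_nonneg_right h (by positivity :
    0 ≤ (1 + ‖t‖) ^ (-(k : ℝ)) * (1 + ‖x‖) ^ (-(k : ℝ))))
  have ht : ‖t‖ ≤ ‖(t, x)‖ := le_max_left _ _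
  have hx : ‖x‖ ≤ ‖(t, x)‖ := le_max_right _ _
  have h1 : 1 ≤ (1 + ‖(t, x)‖) ^ (2 * k) *
      ((1 + ‖t‖) ^ (-(k : ℝ)) * (1 + ‖x‖) ^ (-(k : ℝ))) := by
    rw [Real.rpow_neg (by positivity), Real.rpow_neg (by positivity), Real.rpow_natCast,
      Real.rpow_natCast, ← mul_inv, ← div_eq_mul_inv, one_le_div (by positivity), two_mul, pow_add]
    gcongr
  calc ‖Φ (t, x)‖ ≤ ((1 + ‖(t, x)‖) ^ (2 * k) *
        ((1 + ‖t‖) ^ (-(k : ℝ)) * (1 + ‖x‖) ^ (-(k : ℝ)))) * ‖Φ (t, x)‖ :=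
        le_mul_of_one_le_left (norm_nonneg _) h1
    _ = _ := by ring

theorem integrable_one_add_norm_plane : Integrable fun x : Plane => (1 + ‖x‖) ^ (-((3 : ℕ) : ℝ)) :=
  integrable_one_add_norm (by rw [finrank_euclideanSpace_fin]; norm_num)

theorem integrable_one_add_norm_line : Integrable fun x : ℝ => (1 + ‖x‖) ^ (-((3 : ℕ) : ℝ)) :=
  integrable_one_add_norm (by rw [Module.finrank_self]; norm_num)

theorem rpow_neg_natCast_le_one (k : ℕ) {x : ℝ} (hx : 0 ≤ x) : (1 + x) ^ (-(k : ℝ)) ≤ 1 :=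
  Real.rpow_le_one_of_one_le_of_nonpos (by linarith) (by simp)

theorem integrable_schwartz_spaceTime (Φ : 𝓢(SpaceTime, ℂ)) : Integrable Φ := by
  obtain ⟨C, -, hC⟩ := exists_norm_le_rpow_mul_rpow Φ 3
  exact ((integrable_one_add_norm_line.mul_prod integrable_one_add_norm_plane).const_mul C).mono'
    Φ.continuous.aestronglyMeasurable (ae_of_all _ fun p => hC p.1 p.2)

open FourierTransform in
/-- The space-time Fourier transform of a Schwartz function is a Schwartz function. The plane and
the time axis are glued to a Euclidean space to apply the Fourier transform there. -/
theorem exists_schwartz_eq_spaceTimeFourier (u : 𝓢(SpaceTime, ℂ)) :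
    ∃ U : 𝓢(SpaceTime, ℂ), ∀ q, U q = spaceTimeFourier u q := by
  let e : WithLp 2 (ℝ × Plane) ≃L[ℝ] SpaceTime := WithLp.prodContinuousLinearEquiv 2 ℝ ℝ Plane
  let φ : 𝓢(WithLp 2 (ℝ × Plane), ℂ) := SchwartzMap.compCLMOfContinuousLinearEquiv ℂ e u
  have hr : (2 * Real.pi)⁻¹ ≠ 0 := by simp [Real.pi_ne_zero]
  let m : WithLp 2 (ℝ × Plane) ≃L[ℝ] WithLp 2 (ℝ × Plane) :=
    ContinuousLinearEquiv.smulLeft (Units.mk0 _ hr)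
  refine ⟨SchwartzMap.compCLMOfContinuousLinearEquiv ℂ (e.symm.trans m) (𝓕 φ), fun q => ?_⟩
  have h0 : (SchwartzMap.compCLMOfContinuousLinearEquiv ℂ (e.symm.trans m) (𝓕 φ)) q =
      𝓕 (φ : WithLp 2 (ℝ × Plane) → ℂ) ((2 * Real.pi)⁻¹ • WithLp.toLp 2 q) := by
    rw [← SchwartzMap.fourier_coe]; rfl
  rw [h0, Real.fourier_eq', spaceTimeFourier]
  have h1 := (WithLp.volume_preserving_symm_measurableEquiv_toLp_prod ℝ Plane).integral_comp'
    (fun p : SpaceTime =>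
      Complex.exp (-(Complex.I * ((p.1 * q.1 + inner ℝ p.2 q.2 : ℝ) : ℂ))) * u p)
  rw [← h1]
  refine integral_congr_ae (ae_of_all _ fun v => ?_)
  have h2 : φ v = u v.ofLp := rfl
  have h3 : (MeasurableEquiv.toLp 2 (ℝ × Plane)).symm v = v.ofLp := rfl
  simp only [h2, h3, smul_eq_mul]
  congr 2
  rw [inner_smul_right, WithLp.prod_inner_apply, mul_comm _ Complex.I, ← mul_neg]
  congr 1
  rw [← Complex.ofReal_neg]
  congr 1
  have : inner ℝ v.ofLp.1 q.1 = v.ofLp.1 * q.1 := by simp [mul_comm]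
  rw [this]
  field_simp

theorem norm_exp_I_mul_ofReal (x : ℝ) : ‖Complex.exp (Complex.I * (x : ℂ))‖ = 1 := by
  rw [mul_comm]; exact Complex.norm_exp_ofReal_mul_I x

theorem norm_exp_neg_I_mul_ofReal (x : ℝ) : ‖Complex.exp (-(Complex.I * (x : ℂ)))‖ = 1 := by
  rw [← mul_neg, ← Complex.ofReal_neg]; exact norm_exp_I_mul_ofReal _

open FourierTransform in
/-- Fourier inversion in time for the spatial Fourier transform of a time slice. -/
theorem spaceFourier_slice_eq (u U : 𝓢(SpaceTime, ℂ)) (hU : ∀ q, U q = spaceTimeFourier u q)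
    (t : ℝ) (η : Plane) :
    spaceFourier (fun x => u (t, x)) η =
      (((2 * Real.pi)⁻¹ : ℝ) : ℂ) * ∫ τ : ℝ, Complex.exp (Complex.I * ((t * τ : ℝ) : ℂ)) *
        U (τ, η) := by
  set m : ℝ → ℂ := fun t => spaceFourier (fun x => u (t, x)) η with hm
  have hexp : Continuous fun p : SpaceTime =>
      Complex.exp (-(Complex.I * ((inner ℝ p.2 η : ℝ) : ℂ))) := by fun_prop
  have hF : Integrable fun p : SpaceTime =>
      Complex.exp (-(Complex.I * ((inner ℝ p.2 η : ℝ) : ℂ))) * u p := by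
    refine (integrable_schwartz_spaceTime u).norm.mono' (hexp.mul u.continuous).aestronglyMeasurable
      (ae_of_all _ fun p => ?_)
    rw [norm_mul, norm_exp_neg_I_mul_ofReal, one_mul]
  have hmint : Integrable m := hF.integral_prod_left
  obtain ⟨C, hC0, hC⟩ := exists_norm_le_rpow_mul_rpow u 3
  have hmcont : Continuous m := by
    refine continuous_of_dominated (bound := fun x => C * (1 + ‖x‖) ^ (-((3 : ℕ) : ℝ)))
      (fun t => ?_) (fun t => ae_of_all _ fun x => ?_)
      (integrable_one_add_norm_plane.const_mul C) (ae_of_all _ fun x => ?_)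
    · exact ((hexp.mul u.continuous).comp (by fun_prop :
        Continuous fun x : Plane => ((t, x) : SpaceTime))).aestronglyMeasurable
    · rw [norm_mul, norm_exp_neg_I_mul_ofReal, one_mul]
      refine (hC t x).trans ?_
      gcongr
      exact mul_le_of_le_one_left (by positivity) (rpow_neg_natCast_le_one 3 (norm_nonneg t))
    · exact continuous_const.mul (u.continuous.comp (by fun_prop))
  have hFm : ∀ w : ℝ, 𝓕 m w = U (2 * Real.pi * w, η) := by
    intro w
    have hint : Integrable fun p : SpaceTime =>
        Complex.exp (-(Complex.I * ((p.1 * (2 * Real.pi * w) + inner ℝ p.2 η : ℝ) : ℂ))) * u p := by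
      refine (integrable_schwartz_spaceTime u).norm.mono' (Continuous.aestronglyMeasurable (by
        have := u.continuous; fun_prop)) (ae_of_all _ fun p => ?_)
      rw [norm_mul, norm_exp_neg_I_mul_ofReal, one_mul]
    rw [hU, spaceTimeFourier, Real.fourier_real_eq_integral_exp_smul]
    simp only
    rw [Measure.volume_eq_prod, integral_prod _ hint]
    refine integral_congr_ae (ae_of_all _ fun s => ?_)
    simp only [hm, spaceFourier, smul_eq_mul]
    rw [← integral_const_mul]
    refine integral_congr_ae (ae_of_all _ fun x => ?_)
    simp only
    rw [← mul_assoc, ← Complex.exp_add]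
    congr 2
    push_cast
    ring
  have hUslice : Integrable fun τ : ℝ => U (τ, η) := by
    obtain ⟨D, hD0, hD⟩ := exists_norm_le_rpow_mul_rpow U 3
    refine (integrable_one_add_norm_line.const_mul D).mono'
      (U.continuous.comp (by fun_prop)).aestronglyMeasurable (ae_of_all _ fun τ => ?_)
    refine (hD τ η).trans ?_
    gcongr
    exact mul_le_of_le_one_right (by positivity) (rpow_neg_natCast_le_one 3 (norm_nonneg η))
  have hFint : Integrable (𝓕 m) := by
    have := hUslice.comp_mul_left' (R := 2 * Real.pi) (by positivity)
    exact this.congr (ae_of_all _ fun w => (hFm w).symm)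
  have hinv := congrFun (hmcont.fourierInv_fourier_eq hmint hFint) t
  rw [Real.fourierInv_eq'] at hinv
  rw [show spaceFourier (fun x => u (t, x)) η = m t from rfl, ← hinv]
  have hsub := Measure.integral_comp_mul_left
    (fun τ : ℝ => Complex.exp (Complex.I * ((t * τ : ℝ) : ℂ)) * U (τ, η)) (2 * Real.pi)
  rw [abs_of_pos (by positivity)] at hsub
  rw [← Complex.real_smul, ← hsub]
  refine integral_congr_ae (ae_of_all _ fun w => ?_)
  simp only [smul_eq_mul, hFm]
  congr 2
  rw [mul_comm Complex.I]
  congr 2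
  simp
  ring

/-! ### The space-time Fourier transform of the bilinear expression -/

/-- Up to a constant, the space-time Fourier transform of `(u, v)_{HH → L}` in terms of those of
`u` and `v`. -/
noncomputable def highHighSymbol (κ : ℝ) (U V : SpaceTime → ℂ) (q : SpaceTime) : ℂ :=
  ∫ p : SpaceTime, (highHighSet κ).indicator (fun _ => U p * V (q - p)) (p.2, q.2 - p.2)

theorem measurable_highHighSymbol_integrand (κ : ℝ) {U V : SpaceTime → ℂ} (hU : Measurable U)
    (hV : Measurable V) : Measurable fun x : SpaceTime × SpaceTime =>
      (highHighSet κ).indicator (fun _ => U x.2 * V (x.1 - x.2)) (x.2.2, x.1.2 - x.2.2) := by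
  have hmS : MeasurableSet {x : SpaceTime × SpaceTime | (x.2.2, x.1.2 - x.2.2) ∈ highHighSet κ} :=
    (by fun_prop : Measurable fun x : SpaceTime × SpaceTime => (x.2.2, x.1.2 - x.2.2))
      (measurableSet_highHighSet κ)
  exact ((hU.comp measurable_snd).mul
    (hV.comp (measurable_fst.sub measurable_snd))).indicator hmS

theorem stronglyMeasurable_highHighSymbol (κ : ℝ) {U V : SpaceTime → ℂ} (hU : Measurable U)
    (hV : Measurable V) : StronglyMeasurable (highHighSymbol κ U V) :=
  StronglyMeasurable.integral_prod_right (f := fun q p : SpaceTime =>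
    (highHighSet κ).indicator (fun _ => U p * V (q - p)) (p.2, q.2 - p.2))
    (measurable_highHighSymbol_integrand κ hU hV).stronglyMeasurable

theorem enorm_highHighSymbol_le (κ : ℝ) (U V : SpaceTime → ℂ) (q : SpaceTime) :
    ‖highHighSymbol κ U V q‖ₑ ≤ highHighConv κ (fun p => ‖U p‖ₑ) (fun p => ‖V p‖ₑ) q := by
  refine (enorm_integral_le_lintegral_enorm _).trans (le_of_eq ?_)
  refine lintegral_congr fun p => ?_
  by_cases hp : (p.2, q.2 - p.2) ∈ highHighSet κ
  · rw [Set.indicator_of_mem hp, Set.indicator_of_mem hp, enorm_mul]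
  · rw [Set.indicator_of_notMem hp, Set.indicator_of_notMem hp, enorm_zero]

/-- The spatial Fourier transform of `(u, v)_{HH → L}` at time `t` is an inverse Fourier transform
in time of `highHighSymbol`. -/
theorem hhToLowFourier_slice_eq (κ : ℝ) (u v U V : 𝓢(SpaceTime, ℂ))
    (hU : ∀ q, U q = spaceTimeFourier u q) (hV : ∀ q, V q = spaceTimeFourier v q)
    (t : ℝ) (ξ : Plane) :
    hhToLowFourier κ (fun x => u (t, x)) (fun x => v (t, x)) ξ =
      ((((2 * Real.pi)⁻¹) ^ 2 : ℝ) : ℂ) * ∫ τ : ℝ, Complex.exp (Complex.I * ((t * τ : ℝ) : ℂ)) *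
        highHighSymbol κ U V (τ, ξ) := by
  set E : ℝ → ℂ := fun s => Complex.exp (Complex.I * ((t * s : ℝ) : ℂ)) with hE
  have hEc : Continuous E := by fun_prop
  have hEn : ∀ s, ‖E s‖ = 1 := fun s => norm_exp_I_mul_ofReal _
  have hEadd : ∀ s s', E (s + s') = E s * E s' := by
    intro s s'
    simp only [hE]
    rw [← Complex.exp_add]
    congr 1
    push_cast
    ring
  set S : Set Plane := {η : Plane | κ * ‖ξ‖ ≤ ‖η‖ + ‖ξ - η‖} with hS
  have hSm : MeasurableSet S := measurableSet_le (f := fun _ => κ * ‖ξ‖)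
    (g := fun η : Plane => ‖η‖ + ‖ξ - η‖) measurable_const (by fun_prop)
  have hSmem : ∀ η, (η, ξ - η) ∈ highHighSet κ ↔ η ∈ S := by
    intro η
    simp [highHighSet, hS]
  set χ : Plane → ℂ := S.indicator 1 with hχ
  have hχm : Measurable χ := measurable_one.indicator hSm
  have hχn : ∀ η, ‖χ η‖ ≤ 1 := by
    intro η
    by_cases h : η ∈ S
    · simp [hχ, Set.indicator_of_mem h]
    · simp [hχ, Set.indicator_of_notMem h]
  -- The integrand in the variables `τ₂` and `(τ₁, η)`, where it is dominated by a product.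
  set Θ : ℝ × SpaceTime → ℂ := fun x =>
    (E x.1 * V (x.1, ξ - x.2.2)) * (χ x.2.2 * (E x.2.1 * U x.2)) with hΘ
  obtain ⟨C, hC0, hC⟩ := exists_norm_le_rpow_mul_rpow V 3
  have hΘm : Measurable Θ := by
    have h1 : Measurable fun x : ℝ × SpaceTime => E x.1 * V (x.1, ξ - x.2.2) :=
      ((hEc.comp continuous_fst).mul (V.continuous.comp (by fun_prop))).measurable
    have h2 : Measurable fun x : ℝ × SpaceTime => E x.2.1 * U x.2 :=
      ((hEc.comp (by fun_prop)).mul (U.continuous.comp continuous_snd)).measurable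
    exact h1.mul ((hχm.comp measurable_snd.snd).mul h2)
  have hΘint : Integrable Θ := by
    refine ((integrable_one_add_norm_line.mul_prod
      (integrable_schwartz_spaceTime U).norm).const_mul C).mono'
      hΘm.aestronglyMeasurable (ae_of_all _ fun x => ?_)
    simp only [hΘ, norm_mul, hEn, one_mul]
    have h1 : ‖V (x.1, ξ - x.2.2)‖ ≤ C * (1 + ‖x.1‖) ^ (-((3 : ℕ) : ℝ)) := by
      refine (hC _ _).trans ?_
      gcongr
      exact mul_le_of_le_one_right (by positivity) (rpow_neg_natCast_le_one 3 (norm_nonneg _))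
    calc _ ≤ (C * (1 + ‖x.1‖) ^ (-((3 : ℕ) : ℝ))) * (1 * ‖U x.2‖) := by
          gcongr
          exact hχn _
      _ = _ := by ring
  set Θ' : ℝ × SpaceTime → ℂ := fun x => Θ (x.1 - x.2.1, x.2) with hΘ'
  have hΘ'int : Integrable Θ' := by
    have hm : Measurable Θ' := hΘm.comp (by fun_prop)
    refine (integrable_prod_iff' hm.aestronglyMeasurable).mpr ⟨?_, ?_⟩
    · filter_upwards [hΘint.prod_left_ae] with p hp
      exact hp.comp_sub_right p.1
    · refine hΘint.integral_norm_prod_right.congr (ae_of_all _ fun p => ?_)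
      exact (integral_sub_right_eq_self (fun s => ‖Θ (s, p)‖) p.1).symm
  have hR : ∫ τ : ℝ, E τ * highHighSymbol κ U V (τ, ξ) =
      ∫ η : Plane, χ η * ((∫ τ, E τ * U (τ, η)) * ∫ s, E s * V (s, ξ - η)) := by
    calc ∫ τ : ℝ, E τ * highHighSymbol κ U V (τ, ξ) = ∫ τ : ℝ, ∫ p : SpaceTime, Θ' (τ, p) := by
          refine integral_congr_ae (ae_of_all _ fun τ => ?_)
          simp only [highHighSymbol]
          rw [← integral_const_mul]
          refine integral_congr_ae (ae_of_all _ fun p => ?_)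
          have h1 : E τ = E (τ - p.1) * E p.1 := by rw [← hEadd, sub_add_cancel]
          by_cases hp : p.2 ∈ S
          · simp only [Set.indicator_of_mem ((hSmem _).mpr hp), hΘ', hΘ, hχ,
              Set.indicator_of_mem hp, Pi.one_apply]
            rw [h1, show ((τ, ξ) : SpaceTime) - p = (τ - p.1, ξ - p.2) from rfl]
            ring
          · simp only [Set.indicator_of_notMem (fun h => hp ((hSmem _).mp h)), hΘ', hΘ, hχ,
              Set.indicator_of_notMem hp]
            ring
      _ = ∫ p : SpaceTime, ∫ τ : ℝ, Θ' (τ, p) := integral_integral_swap hΘ'int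
      _ = ∫ p : SpaceTime, ∫ s : ℝ, Θ (s, p) := integral_congr_ae (ae_of_all _ fun p =>
          integral_sub_right_eq_self (fun s => Θ (s, p)) p.1)
      _ = ∫ η : Plane, ∫ τ : ℝ, ∫ s : ℝ, Θ (s, (τ, η)) :=
          integral_prod_symm (fun p : SpaceTime => ∫ s : ℝ, Θ (s, p)) hΘint.integral_prod_right
      _ = _ := by
          refine integral_congr_ae (ae_of_all _ fun η => ?_)
          simp only [hΘ]
          simp_rw [integral_mul_const, integral_const_mul]
          ring
  have hL : hhToLowFourier κ (fun x => u (t, x)) (fun x => v (t, x)) ξ =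
      ∫ η : Plane, ((((2 * Real.pi)⁻¹) ^ 2 : ℝ) : ℂ) *
        (χ η * ((∫ τ, E τ * U (τ, η)) * ∫ s, E s * V (s, ξ - η))) := by
    refine integral_congr_ae (ae_of_all _ fun η => ?_)
    by_cases hη : η ∈ S
    · have eu : spaceFourier (fun x => u (t, x)) η =
          (((2 * Real.pi)⁻¹ : ℝ) : ℂ) * ∫ τ, E τ * U (τ, η) := spaceFourier_slice_eq u U hU t η
      have ev : spaceFourier (fun x => v (t, x)) (ξ - η) =
          (((2 * Real.pi)⁻¹ : ℝ) : ℂ) * ∫ s, E s * V (s, ξ - η) :=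
        spaceFourier_slice_eq v V hV t (ξ - η)
      simp only [hχ]
      rw [Set.indicator_of_mem (by exact hη), Set.indicator_of_mem hη, eu, ev, Pi.one_apply]
      push_cast
      ring
    · simp only [hχ]
      rw [Set.indicator_of_notMem (by exact hη), Set.indicator_of_notMem hη]
      ring
  rw [hL, integral_const_mul, hR]

/-! ### The estimate for the bilinear operator -/

theorem absDHHToLowSpaceTime_eq (a κ : ℝ) (u v U V : 𝓢(SpaceTime, ℂ))
    (hU : ∀ q, U q = spaceTimeFourier u q) (hV : ∀ q, V q = spaceTimeFourier v q)
    (p : SpaceTime) :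
    absDHHToLowSpaceTime a κ u v p = (((2 * Real.pi) ^ 2)⁻¹ : ℝ) *
      ∫ ξ : Plane, Complex.exp (Complex.I * ((inner ℝ p.2 ξ : ℝ) : ℂ)) *
        (((‖ξ‖ ^ a * ((2 * Real.pi)⁻¹) ^ 2 : ℝ) : ℂ) *
          ∫ τ : ℝ, Complex.exp (Complex.I * ((p.1 * τ : ℝ) : ℂ)) *
            highHighSymbol κ U V (τ, ξ)) := by
  simp only [absDHHToLowSpaceTime, absDHHToLow, spaceFourierInv]
  congr 1
  refine integral_congr_ae (ae_of_all _ fun ξ => ?_)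
  simp only
  rw [hhToLowFourier_slice_eq κ u v U V hU hV, Complex.ofReal_mul]
  ring

theorem stronglyMeasurable_exp_integral_highHighSymbol (a κ : ℝ) (U V : 𝓢(SpaceTime, ℂ)) :
    StronglyMeasurable fun x : ℝ × Plane => ((‖x.2‖ ^ a * ((2 * Real.pi)⁻¹) ^ 2 : ℝ) : ℂ) *
      ∫ τ : ℝ, Complex.exp (Complex.I * ((x.1 * τ : ℝ) : ℂ)) *
        highHighSymbol κ U V (τ, x.2) := by
  have hY := stronglyMeasurable_highHighSymbol κ U.continuous.measurable V.continuous.measurable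
  have h1 : StronglyMeasurable (Function.uncurry fun (x : ℝ × Plane) (τ : ℝ) =>
      Complex.exp (Complex.I * ((x.1 * τ : ℝ) : ℂ)) * highHighSymbol κ U V (τ, x.2)) := by
    refine StronglyMeasurable.mul (Continuous.stronglyMeasurable (by fun_prop)) ?_
    exact hY.comp_measurable (g := fun z : (ℝ × Plane) × ℝ => (z.2, z.1.2)) (by fun_prop)
  have h2 : Measurable fun x : ℝ × Plane => ((‖x.2‖ ^ a * ((2 * Real.pi)⁻¹) ^ 2 : ℝ) : ℂ) := by
    fun_prop
  exact h2.stronglyMeasurable.mul h1.integral_prod_right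

theorem stronglyMeasurable_absDHHToLowSpaceTime (a κ : ℝ) (u v : 𝓢(SpaceTime, ℂ)) :
    StronglyMeasurable (absDHHToLowSpaceTime a κ u v) := by
  obtain ⟨U, hU⟩ := exists_schwartz_eq_spaceTimeFourier u
  obtain ⟨V, hV⟩ := exists_schwartz_eq_spaceTimeFourier v
  rw [show absDHHToLowSpaceTime a κ u v = _ from
    funext (absDHHToLowSpaceTime_eq a κ u v U V hU hV)]
  have h1 : StronglyMeasurable (Function.uncurry fun (p : SpaceTime) (ξ : Plane) =>
      Complex.exp (Complex.I * ((inner ℝ p.2 ξ : ℝ) : ℂ)) *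
        (((‖ξ‖ ^ a * ((2 * Real.pi)⁻¹) ^ 2 : ℝ) : ℂ) *
          ∫ τ : ℝ, Complex.exp (Complex.I * ((p.1 * τ : ℝ) : ℂ)) *
            highHighSymbol κ U V (τ, ξ))) := by
    refine StronglyMeasurable.mul (Continuous.stronglyMeasurable (by fun_prop)) ?_
    exact (stronglyMeasurable_exp_integral_highHighSymbol a κ U V).comp_measurable
      (g := fun z : SpaceTime × Plane => (z.1.1, z.2)) (by fun_prop)
  exact h1.integral_prod_right.const_mul _

/-- Plancherel in `x` at each fixed `t`, followed by Plancherel in `t` at each fixed `ξ`. -/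
theorem eLpNorm_absDHHToLowSpaceTime_le (a κ : ℝ) (u v U V : 𝓢(SpaceTime, ℂ))
    (hU : ∀ q, U q = spaceTimeFourier u q) (hV : ∀ q, V q = spaceTimeFourier v q) :
    eLpNorm (absDHHToLowSpaceTime a κ u v) 2 volume ≤
      ENNReal.ofReal ((2 * Real.pi) ^ 2) * l2Norm (fun q : SpaceTime =>
        ENNReal.ofReal (‖q.2‖ ^ a) * highHighConv κ (fun p => ‖U p‖ₑ) (fun p => ‖V p‖ₑ) q) := by
  have hpi : 1 ≤ 2 * Real.pi := by linarith [Real.pi_gt_three]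
  have hpi1 : (2 * Real.pi)⁻¹ ^ 2 ≤ 1 := pow_le_one₀ (by positivity) (inv_le_one_of_one_le₀ hpi)
  set J : ℝ → Plane → ℂ := fun t ξ => ∫ τ : ℝ, Complex.exp (Complex.I * ((t * τ : ℝ) : ℂ)) *
    highHighSymbol κ U V (τ, ξ) with hJ
  set W : ℝ → Plane → ℂ := fun t ξ => ((‖ξ‖ ^ a * ((2 * Real.pi)⁻¹) ^ 2 : ℝ) : ℂ) * J t ξ with hW
  have hWm : Measurable fun x : ℝ × Plane => ‖W x.1 x.2‖ₑ ^ 2 :=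
    (stronglyMeasurable_exp_integral_highHighSymbol a κ U V).measurable.enorm.pow_const 2
  have hYm : Measurable fun q => ‖highHighSymbol κ U V q‖ₑ ^ 2 :=
    (stronglyMeasurable_highHighSymbol κ U.continuous.measurable
      V.continuous.measurable).measurable.enorm.pow_const 2
  have hx : ∀ t : ℝ, ∫⁻ x : Plane, ‖absDHHToLowSpaceTime a κ u v (t, x)‖ₑ ^ 2 ≤
      ENNReal.ofReal ((2 * Real.pi) ^ 2) * ∫⁻ ξ, ‖W t ξ‖ₑ ^ 2 := by
    intro t
    refine le_trans (lintegral_mono fun x => ?_)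
      ((lintegral_sq_enorm_exp_integral_le (W t)).trans (le_of_eq ?_))
    · rw [absDHHToLowSpaceTime_eq a κ u v U V hU hV, enorm_mul]
      refine pow_le_pow_left' (mul_le_of_le_one_left' ?_) 2
      rw [← ofReal_norm, Complex.norm_real, Real.norm_of_nonneg (by positivity),
        ENNReal.ofReal_le_one]
      rwa [inv_pow] at hpi1
    · rw [finrank_euclideanSpace_fin]
  have ht : ∀ ξ : Plane, ∫⁻ t, ‖W t ξ‖ₑ ^ 2 ≤
      ENNReal.ofReal (2 * Real.pi) * ∫⁻ τ, (ENNReal.ofReal (‖ξ‖ ^ a) *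
        ‖highHighSymbol κ U V (τ, ξ)‖ₑ) ^ 2 := by
    intro ξ
    have h1 := lintegral_sq_enorm_exp_integral_le (E := ℝ) fun τ => highHighSymbol κ U V (τ, ξ)
    rw [Module.finrank_self, pow_one] at h1
    calc ∫⁻ t, ‖W t ξ‖ₑ ^ 2 ≤ ∫⁻ t, ENNReal.ofReal (‖ξ‖ ^ a) ^ 2 * ‖J t ξ‖ₑ ^ 2 := by
          refine lintegral_mono fun t => ?_
          rw [← mul_pow]
          refine pow_le_pow_left' ?_ 2
          simp only [hW]
          rw [enorm_mul]
          refine mul_le_mul_left ?_ _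
          rw [← ofReal_norm, Complex.norm_real, Real.norm_of_nonneg (by positivity)]
          exact ENNReal.ofReal_le_ofReal (mul_le_of_le_one_right (by positivity) hpi1)
      _ = ENNReal.ofReal (‖ξ‖ ^ a) ^ 2 * ∫⁻ t, ‖J t ξ‖ₑ ^ 2 :=
          lintegral_const_mul' _ _ (ENNReal.pow_ne_top ENNReal.ofReal_ne_top)
      _ ≤ ENNReal.ofReal (‖ξ‖ ^ a) ^ 2 * (ENNReal.ofReal (2 * Real.pi) *
            ∫⁻ τ, ‖highHighSymbol κ U V (τ, ξ)‖ₑ ^ 2) := by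
          refine mul_le_mul_right (le_trans (le_of_eq ?_) h1) _
          refine lintegral_congr fun t => ?_
          simp [hJ, mul_comm]
      _ = _ := by
          simp_rw [mul_pow]
          rw [lintegral_const_mul' _ _ (ENNReal.pow_ne_top ENNReal.ofReal_ne_top)]
          ring
  have hYm2 : Measurable fun q : SpaceTime =>
      (ENNReal.ofReal (‖q.2‖ ^ a) * ‖highHighSymbol κ U V q‖ₑ) ^ 2 := by
    simp_rw [mul_pow]
    have : Measurable fun q : SpaceTime => ENNReal.ofReal (‖q.2‖ ^ a) ^ 2 := by fun_prop
    exact this.mul hYm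
  rw [eLpNorm_two_eq_l2Norm]
  apply l2Norm_le_of_sq_le
  rw [mul_pow, l2Norm_sq, lintegral_volume_prod
    ((stronglyMeasurable_absDHHToLowSpaceTime a κ u v).measurable.enorm.pow_const 2)]
  calc ∫⁻ t : ℝ, ∫⁻ x : Plane, ‖absDHHToLowSpaceTime a κ u v (t, x)‖ₑ ^ 2
      ≤ ∫⁻ t : ℝ, ENNReal.ofReal ((2 * Real.pi) ^ 2) * ∫⁻ ξ, ‖W t ξ‖ₑ ^ 2 := lintegral_mono hx
    _ = ENNReal.ofReal ((2 * Real.pi) ^ 2) * ∫⁻ ξ, ∫⁻ t, ‖W t ξ‖ₑ ^ 2 := by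
        rw [lintegral_const_mul' _ _ ENNReal.ofReal_ne_top,
          lintegral_lintegral_swap hWm.aemeasurable]
    _ ≤ ENNReal.ofReal ((2 * Real.pi) ^ 2) * ∫⁻ ξ, ENNReal.ofReal (2 * Real.pi) *
          ∫⁻ τ, (ENNReal.ofReal (‖ξ‖ ^ a) * ‖highHighSymbol κ U V (τ, ξ)‖ₑ) ^ 2 :=
        mul_le_mul_right (lintegral_mono ht) _
    _ = ENNReal.ofReal ((2 * Real.pi) ^ 2) * ENNReal.ofReal (2 * Real.pi) *
          ∫⁻ q : SpaceTime, (ENNReal.ofReal (‖q.2‖ ^ a) * ‖highHighSymbol κ U V q‖ₑ) ^ 2 := by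
        rw [lintegral_const_mul' _ _ ENNReal.ofReal_ne_top, lintegral_volume_prod_symm hYm2,
          mul_assoc]
    _ ≤ _ := by
        rw [sq (ENNReal.ofReal ((2 * Real.pi) ^ 2))]
        refine mul_le_mul' (mul_le_mul_right (ENNReal.ofReal_le_ofReal ?_) _)
          (lintegral_mono fun q => ?_)
        · exact le_self_pow₀ hpi two_ne_zero
        · exact pow_le_pow_left' (mul_le_mul_right (enorm_highHighSymbol_le κ U V q) _) 2

theorem l2Norm_xPlusWeight_mul (s b : ℝ) (u U : 𝓢(SpaceTime, ℂ))
    (hU : ∀ q, U q = spaceTimeFourier u q) :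
    l2Norm (fun q => ENNReal.ofReal (xPlusWeight s b q) * ‖U q‖ₑ) =
      ENNReal.ofReal ((2 * Real.pi) ^ (3 / 2 : ℝ)) * xPlusNorm s b u := by
  rw [xPlusNorm, eLpNorm_two_eq_l2Norm, ← mul_assoc, ← ENNReal.ofReal_mul (by positivity),
    ← Real.rpow_add (by positivity)]
  simp only [add_neg_cancel, Real.rpow_zero, ENNReal.ofReal_one, one_mul]
  congr 1
  ext q
  rw [enorm_mul, hU q]
  congr 1
  rw [← ofReal_norm, Complex.norm_real, Real.norm_of_nonneg (by exact (xPlusWeight_pos s b q).le)]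
  rfl

theorem l2Norm_xPlusWeight_mul_lt_top (s b : ℝ) (U : 𝓢(SpaceTime, ℂ)) :
    l2Norm (fun q => ENNReal.ofReal (xPlusWeight s b q) * ‖U q‖ₑ) < ∞ := by
  obtain ⟨k, hk⟩ := exists_nat_ge (|s| + |b| + 3)
  obtain ⟨C, hC0, hC⟩ := exists_norm_le_rpow_mul_rpow U k
  have key : ∀ q : SpaceTime, xPlusWeight s b q * ‖U q‖ ≤
      C * ((1 + ‖q.1‖) ^ (-((3 : ℕ) : ℝ)) * (1 + ‖q.2‖) ^ (-((3 : ℕ) : ℝ))) := by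
    rintro ⟨τ, ξ⟩
    have hT : 1 ≤ 1 + ‖τ‖ := by linarith [norm_nonneg τ]
    have hX : 1 ≤ 1 + ‖ξ‖ := by linarith [norm_nonneg ξ]
    have hT0 : 0 < 1 + ‖τ‖ := by linarith
    have hX0 : 0 < 1 + ‖ξ‖ := by linarith
    have h1 : bracket ‖ξ‖ ^ s ≤ (1 + ‖ξ‖) ^ |s| := by
      rw [bracket, abs_norm]
      exact Real.rpow_le_rpow_of_exponent_le hX (le_abs_self s)
    have h2 : bracket (τ + ‖ξ‖) ^ b ≤ (1 + ‖τ‖) ^ |b| * (1 + ‖ξ‖) ^ |b| := by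
      rw [← Real.mul_rpow hT0.le hX0.le]
      refine (Real.rpow_le_rpow_of_exponent_le (one_le_bracket _) (le_abs_self b)).trans ?_
      refine Real.rpow_le_rpow (bracket_pos _).le ?_ (abs_nonneg b)
      have h3 := abs_add_le τ ‖ξ‖
      rw [abs_norm] at h3
      rw [bracket, Real.norm_eq_abs]
      nlinarith [mul_nonneg (abs_nonneg τ) (norm_nonneg ξ)]
    have h3 : (1 + ‖τ‖) ^ |b| * (1 + ‖τ‖) ^ (-(k : ℝ)) ≤ (1 + ‖τ‖) ^ (-((3 : ℕ) : ℝ)) := by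
      rw [← Real.rpow_add hT0]
      refine Real.rpow_le_rpow_of_exponent_le hT ?_
      push_cast
      linarith [abs_nonneg s]
    have h4 : (1 + ‖ξ‖) ^ |s| * (1 + ‖ξ‖) ^ |b| * (1 + ‖ξ‖) ^ (-(k : ℝ)) ≤
        (1 + ‖ξ‖) ^ (-((3 : ℕ) : ℝ)) := by
      rw [← Real.rpow_add hX0, ← Real.rpow_add hX0]
      refine Real.rpow_le_rpow_of_exponent_le hX ?_
      push_cast
      linarith
    have hb0 : 0 ≤ bracket (τ + ‖ξ‖) ^ b := Real.rpow_nonneg (bracket_pos _).le _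
    calc xPlusWeight s b (τ, ξ) * ‖U (τ, ξ)‖
        ≤ ((1 + ‖ξ‖) ^ |s| * ((1 + ‖τ‖) ^ |b| * (1 + ‖ξ‖) ^ |b|)) *
          (C * ((1 + ‖τ‖) ^ (-(k : ℝ)) * (1 + ‖ξ‖) ^ (-(k : ℝ)))) :=
          mul_le_mul (mul_le_mul h1 h2 hb0 (by positivity)) (hC τ ξ) (norm_nonneg _)
            (by positivity)
      _ = C * (((1 + ‖τ‖) ^ |b| * (1 + ‖τ‖) ^ (-(k : ℝ))) *
          ((1 + ‖ξ‖) ^ |s| * (1 + ‖ξ‖) ^ |b| * (1 + ‖ξ‖) ^ (-(k : ℝ)))) := by ring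
      _ ≤ _ := by gcongr
  have hint : Integrable fun q : SpaceTime =>
      C ^ 2 * ((1 + ‖q.1‖) ^ (-((3 : ℕ) : ℝ)) * (1 + ‖q.2‖) ^ (-((3 : ℕ) : ℝ))) :=
    (integrable_one_add_norm_line.mul_prod integrable_one_add_norm_plane).const_mul _
  refine ENNReal.rpow_lt_top_of_nonneg (by norm_num)
    (ne_of_lt (lt_of_le_of_lt (lintegral_mono fun q => ?_) hint.lintegral_lt_top))
  have hw := (xPlusWeight_pos s b q).le
  beta_reduce
  rw [← ofReal_norm, ← ENNReal.ofReal_mul hw, ← ENNReal.ofReal_pow (by positivity)]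
  refine ENNReal.ofReal_le_ofReal ?_
  have h1 := rpow_neg_natCast_le_one 3 (norm_nonneg q.1)
  have h2 := rpow_neg_natCast_le_one 3 (norm_nonneg q.2)
  set x := (1 + ‖q.1‖) ^ (-((3 : ℕ) : ℝ)) with hx
  set y := (1 + ‖q.2‖) ^ (-((3 : ℕ) : ℝ)) with hy
  have hx0 : 0 ≤ x := by positivity
  have hy0 : 0 ≤ y := by positivity
  calc (xPlusWeight s b q * ‖U q‖) ^ 2 ≤ (C * (x * y)) ^ 2 :=
        pow_le_pow_left₀ (by positivity) (key q) 2
    _ = C ^ 2 * (x * y) * (x * y) := by ring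
    _ ≤ C ^ 2 * (x * y) := mul_le_of_le_one_right (by positivity) (mul_le_one₀ h1 hy0 h2)

end WaveBilinear

theorem mainTheorem7 (s₁ s₂ s₃ ε κ : ℝ)
    (hsum : s₁ + s₂ + s₃ = 1 / 2) (hs₁ : s₁ < 5 / 8) (hs₂ : s₂ < 5 / 8) (hpos : 0 < s₁ + s₂)
    (hε : 0 < ε) (hκ : 1 < κ) :
    ∃ C : ℝ≥0, ∀ u v : 𝓢(WaveBilinear.SpaceTime, ℂ),
      MemLp (WaveBilinear.absDHHToLowSpaceTime (-s₃) κ u v) 2 volume ∧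
      eLpNorm (WaveBilinear.absDHHToLowSpaceTime (-s₃) κ u v) 2 volume ≤
        C * WaveBilinear.xPlusNorm s₁ (1 / 2 + ε) u * WaveBilinear.xPlusNorm s₂ (1 / 2 + ε) v := by
  open WaveBilinear in
  obtain ⟨C, hC⟩ := exists_l2Norm_highHighConv_le (b := 1 / 2 + ε) hκ hpos (by linarith)
  set M : ℝ := (2 * Real.pi) ^ 2 with hM
  set N : ℝ := (2 * Real.pi) ^ (3 / 2 : ℝ) with hN
  refine ⟨M.toNNReal * (C * (N.toNNReal * N.toNNReal)), fun u v => ?_⟩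
  obtain ⟨U, hU⟩ := exists_schwartz_eq_spaceTimeFourier u
  obtain ⟨V, hV⟩ := exists_schwartz_eq_spaceTimeFourier v
  have h1 := eLpNorm_absDHHToLowSpaceTime_le (-s₃) κ u v U V hU hV
  have h2 := hC U.continuous.measurable.enorm V.continuous.measurable.enorm
  rw [show s₁ + s₂ - 1 / 2 = -s₃ by linarith] at h2
  have h3 := h1.trans (mul_le_mul_right h2 _)
  refine ⟨⟨(stronglyMeasurable_absDHHToLowSpaceTime _ κ u v).aestronglyMeasurable,
    h3.trans_lt ?_⟩, h3.trans (le_of_eq ?_)⟩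
  · exact ENNReal.mul_lt_top ENNReal.ofReal_lt_top (ENNReal.mul_lt_top ENNReal.coe_lt_top
      (ENNReal.mul_lt_top (l2Norm_xPlusWeight_mul_lt_top _ _ U)
        (l2Norm_xPlusWeight_mul_lt_top _ _ V)))
  · rw [l2Norm_xPlusWeight_mul _ _ u U hU, l2Norm_xPlusWeight_mul _ _ v V hV]
    push_cast
    simp only [ENNReal.ofReal]
    ring
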